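/- All graphs are finite and simple, surfaces are closed and connected (orientable or not), and graphs are drawn without crossings; the drawing need not be cellular and the graph need not be connected. Colorings need not be proper. Let $c\ge 2$ be an integer. For a graph $S$ and an assignment $B$ of multisets of colors to its vertices, a coloring of $S$ is *$B$-opaque* if for each color $a$, each connected subgraph of $S$ all of whose vertices have color $a$ contains at most one vertex $v$ with $a\in B(v)$, and if there is such a vertex $v$, then $a$ has multiplicity one in $B(v)$. A *$c$-sparsifier* is a pair $(S,\gamma)$, where $S$ is a (non-empty) connected graph and $\gamma$ assigns to each vertex $v$ of $S$ an integer $\gamma(v)\ge\deg_S v$, such that for every assignment $L$ of sets of $c$ colors to the vertices of $S$ and every assignment $B$ of multisets of colors with $|B(v)|\le\gamma(v)-\deg_S v$ for all $v\in V(S)$, there is a $B$-opaque coloring $\varphi$ of $S$ with $\varphi(v)\in L(v)$ for all $v\in V(S)$. Its *size* is $|V(S)|$. For $c\in\{2,3\}$ let $t=\frac{2c}{c-1}$. An *appearance* of a $c$-sparsifier $(S,\gamma)$ in a graph $G$ drawn on a surface is an injective function $h:V(S)\to V(G)$ such that for all $u,v\in V(S)$ we have $uv\in E(S)$ if and only if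 $h(u)h(v)\in E(G)$, and for every $u\in V(S)$ we have $\deg_G h(u)\le\gamma(u)$ and every face of $G$ incident with $h(u)$ is bounded by a cycle of length $t$ (that is, the boundary of the face is such a cycle). A cycle $C$ of $G$ is *separating* if two vertices of $G$ outside $C$ lie in different connected components of the complement of $C$ in the surface, and it is *non-contractible* if it is not null-homotopic in the surface. **Lemma.** For each $c\in\{2,3\}$ there exists a constant $\varepsilon_c>0$ such that the following holds, where $t=\frac{2c}{c-1}$. Let $G$ be a graph of minimum degree at least $c$ and girth at least $t$ drawn on a surface of Euler genus $g$ so that $G$ has no non-contractible cycle of length at most $4$. Suppose that no $c$-sparsifier of size at most $4$ has an appearance in $G$ and that $G$ has no separating cycle of length $t$. Then $$|E(G)|\le (c-\varepsilon_c)\,|V(G)|+10(g+3).$$ -/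

import Mathlib

/-! ### Closed surfaces

A closed surface is presented by a finite triangulation: a set of three-element sets of points
such that every edge lies in exactly two triangles, the link of every point is a cycle, and the
1-skeleton is connected. -/

/-- The 1-skeleton of a set of triangles: two points are adjacent when some triangle contains
both. -/
def skeletonOf {X : Type*} (T : Finset (Finset X)) : SimpleGraph X where
  Adj x y := x ≠ y ∧ ∃ τ ∈ T, x ∈ τ ∧ y ∈ τ
  symm := ⟨fun _ _ h => ⟨h.1.symm, h.2.imp fun _ k => ⟨k.1, k.2.2, k.2.1⟩⟩⟩
  loopless := ⟨fun _ h => h.1 rfl⟩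

/-- The link of a point `x`: its vertices are the neighbors of `x`, and `y`, `z` are adjacent when
`x`, `y`, `z` are the corners of a triangle. -/
def linkOf {X : Type*} [DecidableEq X] (T : Finset (Finset X)) (x : X) :
    SimpleGraph {y : X // (skeletonOf T).Adj x y} where
  Adj y z := y ≠ z ∧ ({x, y.1, z.1} : Finset X) ∈ T
  symm := ⟨fun y z h => ⟨h.1.symm, by rw [Finset.pair_comm]; exact h.2⟩⟩
  loopless := ⟨fun _ h => h.1 rfl⟩

/-- A triangulated closed connected surface (orientable or not, without boundary) with point
set `X`. Since every edge lies in exactly two triangles, all links are 2-regular, so that a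
connected link is a cycle. -/
structure ClosedSurface (X : Type*) [Fintype X] [DecidableEq X] where
  triangles : Finset (Finset X)
  card_triangle : ∀ τ ∈ triangles, τ.card = 3
  edge_two : ∀ x y, (skeletonOf triangles).Adj x y →
    (triangles.filter fun τ => x ∈ τ ∧ y ∈ τ).card = 2
  link_connected : ∀ x, (linkOf triangles x).Connected
  connected : (skeletonOf triangles).Connected

namespace ClosedSurface

variable {X : Type*} [Fintype X] [DecidableEq X]

/-- The 1-skeleton of the triangulation. -/
def skeleton (S : ClosedSurface X) : SimpleGraph X := skeletonOf S.triangles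

/-- The Euler characteristic: points minus edges plus triangles. -/
noncomputable def eulerChar (S : ClosedSurface X) : ℤ :=
  (Fintype.card X : ℤ) - (S.skeleton.edgeSet.ncard : ℤ) + (S.triangles.card : ℤ)

/-- The Euler genus: `0` for the sphere, `1` for the projective plane, `2` for the torus and the
Klein bottle, and so on. -/
noncomputable def eulerGenus (S : ClosedSurface X) : ℤ := 2 - S.eulerChar

/-- Cut the surface along a set `D` of edges: triangles are adjacent when they share an edge that
is not in `D`. The connected components of this graph are the connected components of the
complement, in the surface, of the union of `D` (the triangles around a point outside that union
are linked through edges outside `D`, and finitely many isolated points do not matter). -/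
def cutGraph (S : ClosedSurface X) (D : Set (Sym2 X)) :
    SimpleGraph {τ : Finset X // τ ∈ S.triangles} where
  Adj σ τ := σ ≠ τ ∧ ∃ x y, x ≠ y ∧ (x ∈ σ.1 ∧ y ∈ σ.1) ∧ (x ∈ τ.1 ∧ y ∈ τ.1) ∧ s(x, y) ∉ D
  symm := ⟨fun _ _ ⟨h, x, y, hxy, h1, h2, hD⟩ => ⟨h.symm, x, y, hxy, h2, h1, hD⟩⟩
  loopless := ⟨fun _ h => h.1 rfl⟩

/-- Elementary homotopies of edge paths, written as lists of consecutive points: remove a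
backtracking `x y x`, or replace two sides `x y z` of a triangle by the third side `x z`. -/
inductive ElementaryHomotopy (S : ClosedSurface X) : List X → List X → Prop
  | backtrack (l r : List X) (x y : X) (h : S.skeleton.Adj x y) :
      ElementaryHomotopy S (l ++ x :: y :: x :: r) (l ++ x :: r)
  | triangle (l r : List X) (x y z : X) (h : ({x, y, z} : Finset X) ∈ S.triangles) :
      ElementaryHomotopy S (l ++ x :: y :: z :: r) (l ++ x :: z :: r)

/-- Homotopy of edge paths relative to their ends. -/
def PathHomotopic (S : ClosedSurface X) : List X → List X → Prop :=
  Relation.EqvGen S.ElementaryHomotopy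

end ClosedSurface

/-! ### Drawings of graphs -/

/-- A drawing (without crossings) of `G` on the surface: vertices of `G` are drawn as distinct
points, edges of `G` as edges of the triangulation. Other points and edges of the triangulation
may be present, so that faces need not be disks and `G` need not be connected. -/
abbrev Drawing {X V : Type*} [Fintype X] [DecidableEq X] (G : SimpleGraph V)
    (S : ClosedSurface X) : Type _ :=
  SimpleGraph.Copy G S.skeleton

namespace Drawing

variable {X V : Type*} [Fintype X] [DecidableEq X] {G : SimpleGraph V} {S : ClosedSurface X}

/-- The edges of the triangulation that are used by the drawing. -/
def edges (D : Drawing G S) : Set (Sym2 X) := Sym2.map D '' G.edgeSet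

/-- The faces of the drawing: the connected components of the complement of `G`. -/
def Face (D : Drawing G S) : Type _ := (S.cutGraph D.edges).ConnectedComponent

/-- The triangles that make up a face. -/
def Face.triangles {D : Drawing G S} (f : D.Face) : Set {τ : Finset X // τ ∈ S.triangles} :=
  SimpleGraph.ConnectedComponent.supp f

/-- The vertex `v` of `G` lies on the boundary of the face `f`. -/
def Face.IncidentVertex {D : Drawing G S} (f : D.Face) (v : V) : Prop :=
  ∃ τ ∈ f.triangles, D v ∈ τ.1

/-- The edge `e` of `G` lies on the boundary of the face `f`. -/
def Face.IncidentEdge {D : Drawing G S} (f : D.Face) (e : Sym2 V) : Prop :=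
  e ∈ G.edgeSet ∧ ∃ τ ∈ f.triangles, ∀ v ∈ e, D v ∈ τ.1

/-- The boundary of the face `f` is a cycle of `G` of length `t`. -/
def Face.IsBoundedByCycle {D : Drawing G S} (f : D.Face) (t : ℕ) : Prop :=
  ∃ (v : V) (C : G.Walk v v), C.IsCycle ∧ C.length = t ∧
    (∀ u, f.IncidentVertex u ↔ u ∈ C.support) ∧ (∀ e, f.IncidentEdge e ↔ e ∈ C.edges)

/-- A closed walk of `G` is contractible (null-homotopic) in the surface. -/
def IsContractible (D : Drawing G S) {v : V} (C : G.Walk v v) : Prop :=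
  S.PathHomotopic (C.support.map D) [D v]

/-- A cycle `C` of `G` is separating when two vertices of `G` outside `C` lie in different
connected components of the complement of `C` in the surface. -/
def IsSeparating (D : Drawing G S) {v : V} (C : G.Walk v v) : Prop :=
  ∃ u w : V, u ∉ C.support ∧ w ∉ C.support ∧
    ∀ σ τ : {τ : Finset X // τ ∈ S.triangles}, D u ∈ σ.1 → D w ∈ τ.1 →
      ¬ (S.cutGraph (Sym2.map D '' {e | e ∈ C.edges})).Reachable σ τ

end Drawing

/-! ### Sparsifiers -/

/-- A coloring `φ` of `S` is opaque for the multiassignment `B`: every connected subgraph of `S`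
of a single color `a` contains at most one vertex `v` with `a ∈ B v`, and for such a vertex `a` has
multiplicity one in `B v`. -/
def IsOpaque {W : Type*} (S : SimpleGraph W) (B : W → Multiset ℕ) (φ : W → ℕ) : Prop :=
  ∀ (a : ℕ) (H : S.Subgraph), H.Connected → (∀ v ∈ H.verts, φ v = a) →
    (∀ u ∈ H.verts, ∀ v ∈ H.verts, a ∈ B u → a ∈ B v → u = v) ∧
    (∀ v ∈ H.verts, a ∈ B v → (B v).count a = 1)

/-- `(S, γ)` is a `c`-sparsifier. Colors are natural numbers; colorings need not be proper. -/
def IsSparsifier {W : Type*} [Fintype W] (c : ℕ) (S : SimpleGraph W) [DecidableRel S.Adj]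
    (γ : W → ℕ) : Prop :=
  S.Connected ∧ (∀ v, S.degree v ≤ γ v) ∧
    ∀ (L : W → Finset ℕ) (B : W → Multiset ℕ), (∀ v, (L v).card = c) →
      (∀ v, Multiset.card (B v) + S.degree v ≤ γ v) →
      ∃ φ : W → ℕ, (∀ v, φ v ∈ L v) ∧ IsOpaque S B φ

namespace Drawing

variable {X V W : Type*} [Fintype X] [DecidableEq X] {G : SimpleGraph V} {S : ClosedSurface X}

/-- The embedding `h` of the graph `H` into `G` as an induced subgraph is an appearance of the
`c`-sparsifier `(H, γ)` in the drawn graph `G`. For `c = 2, 3` the number `2 * c / (c - 1)` is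
`4, 3`. -/
def IsAppearance [Fintype V] [DecidableRel G.Adj] (D : Drawing G S) (c : ℕ) {H : SimpleGraph W}
    (γ : W → ℕ) (h : H ↪g G) : Prop :=
  ∀ u : W, G.degree (h u) ≤ γ u ∧
    ∀ f : D.Face, f.IncidentVertex (h u) → f.IsBoundedByCycle (2 * c / (c - 1))

/-- No `c`-sparsifier of size at most `p` has an appearance in the drawn graph `G`. -/
def SparsifierFree [Fintype V] [DecidableRel G.Adj] (D : Drawing G S) (c p : ℕ) : Prop :=
  ∀ (n : ℕ) (H : SimpleGraph (Fin n)) [DecidableRel H.Adj] (γ : Fin n → ℕ), n ≤ p →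
    IsSparsifier c H γ → ∀ h : H ↪g G, ¬ D.IsAppearance c γ h

end Drawing

/-! Suppose that $G$ has $n$ vertices and more edges than claimed, with $\varepsilon = 1/10000$. Let
$q$ be the sum of (length $-\ t$) over all faces. Every face has length at least $t$, so Euler's
inequality gives $|E| \le c(n+g-2) - q/(t-2)$. Hence both $q$ and $g$ are small compared with $n$,
and few vertices lie on a face of length other than $t$. Any remaining vertex has only $t$-cycles as
faces, so it has degree at least $2c$: a single vertex of smaller degree is a sparsifier. As the
average degree is close to $2c$, few vertices exceed degree $2c$. Since the total excess degree is
also small, the exceptional vertices with everything within distance two of them do not exhaust $V$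
(`exists_regular_neighborhood`).

Around a vertex $u$ that is left over, everything is regular. For $c = 2$ a face at $u$ is an
induced 4-cycle by girth; for $c = 3$ the two triangles at an edge $uv$ form an induced diamond,
because an edge between their apexes would give a separating triangle (`exists_diamond`). Both
graphs, with $\gamma = 2c$, are sparsifiers (`isSparsifier_quadrangle`, `isSparsifier_diamond`), a
contradiction.

The topology is chains modulo 2. Euler's inequality is a dimension count (`eulerChar_le`); face
boundaries contain cycles because the boundary of a boundary vanishes (`sum_sideCount_eq_zero`); and
a contractible cycle bounds a 2-chain, which tells its two sides apart (`exists_side_function`). -/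

namespace ClosedSurface

/-! ### Local structure and connectivity of triangulated surfaces. -/

variable {X : Type*} [Fintype X] [DecidableEq X] (S : ClosedSurface X)

/-- The triangles of the surface, as a type. -/
abbrev Tri : Type _ := {τ : Finset X // τ ∈ S.triangles}

variable {S}

theorem Tri.ne_of_adj {p q : X} (h : S.skeleton.Adj p q) : p ≠ q := h.1

theorem Tri.adj {τ : S.Tri} {p q : X} (hpq : p ≠ q) (hp : p ∈ τ.1) (hq : q ∈ τ.1) :
    S.skeleton.Adj p q := ⟨hpq, τ.1, τ.2, hp, hq⟩

theorem Tri.exists_other {τ : S.Tri} {p : X} (hp : p ∈ τ.1) : ∃ q, p ≠ q ∧ q ∈ τ.1 := by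
  have h1 : 0 < (τ.1.erase p).card := by
    rw [Finset.card_erase_of_mem hp, S.card_triangle τ.1 τ.2]; norm_num
  obtain ⟨q, hq⟩ := Finset.card_pos.1 h1
  exact ⟨q, (Finset.ne_of_mem_erase hq).symm, Finset.mem_of_mem_erase hq⟩

theorem filter_triangles_card {p q : X} (h : S.skeleton.Adj p q) :
    (Finset.univ.filter fun τ : S.Tri => p ∈ τ.1 ∧ q ∈ τ.1).card = 2 := by
  rw [← S.edge_two p q h, ← Finset.card_map (Function.Embedding.subtype _)]
  congr 1
  ext τ
  simp only [Finset.mem_map, Finset.mem_filter, Finset.mem_univ, true_and,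
    Function.Embedding.subtype_apply, Subtype.exists, exists_and_right, exists_eq_right]
  tauto

theorem exists_sides {p q : X} (h : S.skeleton.Adj p q) :
    ∃ σ τ : S.Tri, σ ≠ τ ∧ (Finset.univ.filter fun ρ : S.Tri => p ∈ ρ.1 ∧ q ∈ ρ.1) = {σ, τ} :=
  Finset.card_eq_two.1 (filter_triangles_card h)

theorem exists_other_side {p q : X} {σ : S.Tri} (hpq : p ≠ q) (hp : p ∈ σ.1) (hq : q ∈ σ.1) :
    ∃ τ : S.Tri, σ ≠ τ ∧ (Finset.univ.filter fun ρ : S.Tri => p ∈ ρ.1 ∧ q ∈ ρ.1) = {σ, τ} := by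
  obtain ⟨σ', τ, hne, he⟩ := exists_sides (Tri.adj hpq hp hq)
  have : σ ∈ (Finset.univ.filter fun ρ : S.Tri => p ∈ ρ.1 ∧ q ∈ ρ.1) := by simp [hp, hq]
  rw [he] at this
  simp only [Finset.mem_insert, Finset.mem_singleton] at this
  rcases this with rfl | rfl
  · exact ⟨τ, hne, he⟩
  · exact ⟨σ', hne.symm, by rw [he, Finset.pair_comm]⟩

/-- A set of triangles that is closed under crossing the edges at `x` contains all or none of the
triangles at `x`. -/
theorem mem_of_star_closed (H : Set S.Tri) {x : X}
    (hH : ∀ y, x ≠ y → ∀ σ τ : S.Tri, x ∈ σ.1 → y ∈ σ.1 → x ∈ τ.1 → y ∈ τ.1 → σ ∈ H → τ ∈ H)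
    {σ τ : S.Tri} (hσ : x ∈ σ.1) (hτ : x ∈ τ.1) (h : σ ∈ H) : τ ∈ H := by
  obtain ⟨y, hxy, hy⟩ := Tri.exists_other hσ
  obtain ⟨z, hxz, hz⟩ := Tri.exists_other hτ
  have key : ∀ a b : {y : X // (skeletonOf S.triangles).Adj x y},
      (linkOf S.triangles x).Reachable a b →
      (∀ ρ : S.Tri, x ∈ ρ.1 → a.1 ∈ ρ.1 → ρ ∈ H) → ∀ ρ : S.Tri, x ∈ ρ.1 → b.1 ∈ ρ.1 → ρ ∈ H := by
    rintro a b ⟨w⟩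
    induction w with
    | nil => exact id
    | @cons a c b hac _ ih =>
      intro ha
      refine ih fun ρ hx hc => ?_
      refine hH c.1 c.2.1 ⟨_, hac.2⟩ ρ (by simp) (by simp) hx hc ?_
      exact ha _ (by simp) (by simp)
  exact key ⟨y, Tri.adj hxy hσ hy⟩ ⟨z, Tri.adj hxz hτ hz⟩ ((S.link_connected x).preconnected _ _)
    (fun ρ h1 h2 => hH y hxy σ ρ hσ hy h1 h2 h) τ hτ hz

theorem exists_tri_of_adj {p q : X} (h : S.skeleton.Adj p q) :
    ∃ τ : S.Tri, p ∈ τ.1 ∧ q ∈ τ.1 :=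
  h.2.elim fun τ k => ⟨⟨τ, k.1⟩, k.2⟩

/-- The surface is connected through its triangles: membership spreads over whole stars, and from
star to star along the connected 1-skeleton. -/
theorem mem_of_closed (H : Set S.Tri)
    (hH : ∀ x y, x ≠ y → ∀ σ τ : S.Tri, x ∈ σ.1 → y ∈ σ.1 → x ∈ τ.1 → y ∈ τ.1 → σ ∈ H → τ ∈ H)
    {σ : S.Tri} (h : σ ∈ H) (τ : S.Tri) : τ ∈ H := by
  have hne : ∀ ρ : S.Tri, ∃ p, p ∈ ρ.1 := fun ρ =>
    Finset.card_pos.1 (by rw [S.card_triangle ρ.1 ρ.2]; norm_num)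
  have key : ∀ a b : X, S.skeleton.Reachable a b → (∀ ρ : S.Tri, a ∈ ρ.1 → ρ ∈ H) →
      ∀ ρ : S.Tri, b ∈ ρ.1 → ρ ∈ H := by
    rintro a b ⟨w⟩
    induction w with
    | nil => exact id
    | @cons a c b hac _ ih =>
      intro ha
      refine ih fun ρ hc => ?_
      obtain ⟨π, h1, h2⟩ := exists_tri_of_adj hac
      exact mem_of_star_closed H (hH c) h2 hc (ha _ h1)
  obtain ⟨p, hp⟩ := hne σ
  obtain ⟨q, hq⟩ := hne τ
  exact key p q (S.connected.preconnected p q) (fun ρ hρ => mem_of_star_closed H (hH p) hp hρ h) τ hq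

theorem sum_sides {M : Type*} [AddCommMonoid M] (f : S.Tri → M) {p q : X} {σ τ : S.Tri}
    (hne : σ ≠ τ) (he : (Finset.univ.filter fun ρ : S.Tri => p ∈ ρ.1 ∧ q ∈ ρ.1) = {σ, τ}) :
    ∑ ρ : S.Tri with p ∈ ρ.1 ∧ q ∈ ρ.1, f ρ = f σ + f τ := by
  rw [he, Finset.sum_pair hne]

/-- The boundary of a boundary vanishes, here at `x`: a triangle at `x` is counted once for each of
its two other corners. -/
theorem star_sum_eq_zero (f : S.Tri → ZMod 2) (x : X) :
    ∑ y : X with x ≠ y, ∑ ρ : S.Tri with x ∈ ρ.1 ∧ y ∈ ρ.1, f ρ = 0 := by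
  rw [Finset.sum_comm' (t' := Finset.univ.filter fun ρ : S.Tri => x ∈ ρ.1)
    (s' := fun ρ => ρ.1.erase x)]
  · refine Finset.sum_eq_zero fun ρ hρ => ?_
    rw [Finset.sum_const, Finset.card_erase_of_mem (Finset.mem_filter.1 hρ).2,
      S.card_triangle ρ.1 ρ.2]
    exact CharTwo.two_nsmul _
  · intro y ρ
    simp only [Finset.mem_filter, Finset.mem_univ, true_and, Finset.mem_erase]
    exact ⟨fun h => ⟨⟨h.1.symm, h.2.2⟩, h.2.1⟩, fun h => ⟨h.1.1.symm, h.2, h.1.2⟩⟩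

/-! ### The Euler inequality -/

section Euler

open Classical

variable (S) (D : Set (Sym2 X)) (Y : Set X)

/-- The edges of the triangulation outside `D`. -/
abbrev FreeEdge : Type _ := {e : Sym2 X // e ∈ S.skeleton.edgeSet ∧ e ∉ D}

/-- The boundary of a 2-chain modulo 2, restricted to the edges outside `D`. -/
noncomputable def freeBoundary : (S.Tri → ZMod 2) →ₗ[ZMod 2] (S.FreeEdge D → ZMod 2) where
  toFun f e := ∑ ρ : S.Tri with ∀ p ∈ e.1, p ∈ ρ.1, f ρ
  map_add' f g := by ext; simp [Finset.sum_add_distrib]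
  map_smul' a f := by ext; simp [Finset.mul_sum]

/-- The boundary of a 1-chain modulo 2, restricted to the points outside `Y`. -/
noncomputable def freeVertexBoundary :
    (S.FreeEdge D → ZMod 2) →ₗ[ZMod 2] ({x : X // x ∉ Y} → ZMod 2) where
  toFun g x := ∑ e : S.FreeEdge D with x.1 ∈ e.1, g e
  map_add' f g := by ext; simp [Finset.sum_add_distrib]
  map_smul' a f := by ext; simp [Finset.mul_sum]

variable {S D Y}

/-- An edge lies in exactly two triangles, so the boundary vanishes there modulo 2 exactly when
their values agree. -/
theorem mem_ker_freeBoundary {f : S.Tri → ZMod 2} :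
    f ∈ LinearMap.ker (freeBoundary S D) ↔ ∀ σ τ, (S.cutGraph D).Adj σ τ → f σ = f τ := by
  rw [LinearMap.mem_ker]
  constructor
  · rintro h σ τ ⟨hne, x, y, hxy, hσ, hτ, hD⟩
    have h1 := congrFun h ⟨s(x, y), Tri.adj hxy hσ.1 hσ.2, hD⟩
    obtain ⟨τ', hne', he⟩ := exists_other_side hxy hσ.1 hσ.2
    have hτ' : τ = τ' := by
      have : τ ∈ (Finset.univ.filter fun ρ : S.Tri => x ∈ ρ.1 ∧ y ∈ ρ.1) := by simp [hτ]
      rw [he] at this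
      simpa [hne.symm] using this
    subst hτ'
    have h2 := sum_sides f hne he
    simp only [freeBoundary, LinearMap.coe_mk, AddHom.coe_mk, Sym2.ball, Pi.zero_apply] at h1
    rw [h1] at h2
    exact CharTwo.add_eq_zero.1 h2.symm
  · intro h
    ext ⟨e, he, hD⟩
    induction e with
    | _ x y =>
    obtain ⟨σ, τ, hne, hs⟩ := exists_sides (S := S) he
    have hm : ∀ ρ, ρ ∈ ({σ, τ} : Finset S.Tri) → x ∈ ρ.1 ∧ y ∈ ρ.1 := fun ρ hρ => by
      rw [← hs] at hρ; simpa using hρ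
    have h2 := sum_sides f hne hs
    simp only [freeBoundary, LinearMap.coe_mk, AddHom.coe_mk, Sym2.ball, Pi.zero_apply]
    rw [h2, h σ τ ⟨hne, x, y, he.1, hm _ (by simp), hm _ (by simp), hD⟩]
    exact CharTwo.add_self_eq_zero _

theorem eq_of_reachable {M : Type*} {f : S.Tri → M}
    (hf : ∀ σ τ, (S.cutGraph D).Adj σ τ → f σ = f τ) {σ τ : S.Tri}
    (h : (S.cutGraph D).Reachable σ τ) : f σ = f τ := by
  obtain ⟨p⟩ := h
  induction p with
  | nil => rfl
  | cons h _ ih => exact (hf _ _ h).trans ih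

/-- 2-chains whose boundary lies in `D` are the functions on the components of the complement. -/
noncomputable def kerFreeBoundaryEquiv : LinearMap.ker (freeBoundary S D) ≃ₗ[ZMod 2]
    ((S.cutGraph D).ConnectedComponent → ZMod 2) where
  toFun f := SimpleGraph.ConnectedComponent.lift f.1 fun _ _ p _ =>
    eq_of_reachable (mem_ker_freeBoundary.1 f.2) p.reachable
  invFun g := ⟨fun τ => g ((S.cutGraph D).connectedComponentMk τ), mem_ker_freeBoundary.2
    fun σ τ h => congrArg g (SimpleGraph.ConnectedComponent.sound h.reachable)⟩
  left_inv f := by ext; rfl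
  right_inv g := by
    ext c
    induction c using SimpleGraph.ConnectedComponent.ind
    rfl
  map_add' f g := by
    ext c
    induction c using SimpleGraph.ConnectedComponent.ind
    rfl
  map_smul' a f := by
    ext c
    induction c using SimpleGraph.ConnectedComponent.ind
    rfl

/-- The number of free edges at `x` in a triangle `τ ∋ x`, when no edge of `D` ends at `x`. -/
theorem card_freeEdge_filter {x : X} (hx : ∀ e ∈ D, x ∉ e) {τ : S.Tri} (hτ : x ∈ τ.1) :
    (Finset.univ.filter fun e : S.FreeEdge D => x ∈ e.1 ∧ ∀ p ∈ e.1, p ∈ τ.1).card = 2 := by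
  have h2 : (τ.1.erase x).card = 2 := by
    rw [Finset.card_erase_of_mem hτ, S.card_triangle τ.1 τ.2]
  rw [← h2, ← Finset.card_map (Function.Embedding.subtype _),
    ← Finset.card_image_of_injective (f := fun y => s(x, y)) (τ.1.erase x)
      (fun a b h => Sym2.congr_right.1 h)]
  congr 1
  ext e
  induction e with
  | _ a b =>
  simp only [Finset.mem_map, Finset.mem_filter, Finset.mem_univ, true_and,
    Function.Embedding.subtype_apply, Finset.mem_image, Finset.mem_erase]
  constructor
  · rintro ⟨⟨e, he⟩, ⟨h1, h2⟩, rfl⟩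
    obtain ⟨y, hy⟩ := Sym2.mem_iff_exists.1 h1
    simp only at hy
    have he' : s(x, y) ∈ S.skeleton.edgeSet := hy ▸ he.1
    have hyτ : y ∈ τ.1 := h2 y (by simp [hy])
    exact ⟨y, ⟨(Tri.ne_of_adj he').symm, hyτ⟩, hy.symm⟩
  · rintro ⟨y, ⟨h1, h2⟩, h3⟩
    refine ⟨⟨s(x, y), Tri.adj h1.symm hτ h2, fun h => hx _ h (by simp)⟩, ⟨by simp, ?_⟩, h3⟩
    simp [hτ, h2]

/-- The boundary of a boundary vanishes in the relative complex too: no edge of `D` ends at a point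
outside `Y`, so both sides of a triangle at that point are free. -/
theorem range_freeBoundary_le (hD : ∀ e ∈ D, ∀ x ∈ e, x ∈ Y) :
    LinearMap.range (freeBoundary S D) ≤ LinearMap.ker (freeVertexBoundary S D Y) := by
  rintro _ ⟨f, rfl⟩
  rw [LinearMap.mem_ker]
  ext ⟨x, hx⟩
  simp only [freeBoundary, freeVertexBoundary, LinearMap.coe_mk, AddHom.coe_mk, Pi.zero_apply]
  rw [Finset.sum_comm' (t' := Finset.univ.filter fun ρ : S.Tri => x ∈ ρ.1)
    (s' := fun ρ => Finset.univ.filter fun e : S.FreeEdge D => x ∈ e.1 ∧ ∀ p ∈ e.1, p ∈ ρ.1)]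
  · refine Finset.sum_eq_zero fun ρ hρ => ?_
    rw [Finset.sum_const, card_freeEdge_filter (fun e he hxe => hx (hD e he x hxe))
      (Finset.mem_filter.1 hρ).2]
    exact CharTwo.two_nsmul _
  · intro e ρ
    simp only [Finset.mem_filter, Finset.mem_univ, true_and]
    exact ⟨fun h => ⟨h, h.2 _ h.1⟩, fun h => h.1⟩

/-- A path from `x` to a point of `Y` bounds the indicator of `x`, since points of `Y` count as
zero. When the path uses an edge of `D`, its starting point is already in `Y`. -/
theorem freeVertexBoundary_surjective (hD : ∀ e ∈ D, ∀ x ∈ e, x ∈ Y) (hY : Y.Nonempty) :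
    Function.Surjective (freeVertexBoundary S D Y) := by
  obtain ⟨y, hy⟩ := hY
  have hzero : ∀ {x : X}, x ∈ Y →
      (fun u : {x : X // x ∉ Y} => if u.1 = x then (1 : ZMod 2) else 0) = 0 := by
    intro x hx
    ext u
    have : u.1 ≠ x := fun h => u.2 (h.symm ▸ hx)
    simp [this]
  have key : ∀ x : X, (fun u : {x : X // x ∉ Y} => if u.1 = x then (1 : ZMod 2) else 0) ∈
      LinearMap.range (freeVertexBoundary S D Y) := by
    intro x
    obtain ⟨w⟩ := S.connected.preconnected x y
    induction w with
    | nil =>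
      rw [hzero hy]
      exact Submodule.zero_mem _
    | @cons a b c hab _ ih =>
      have hb := ih hy
      by_cases he : s(a, b) ∈ D
      · rw [hzero (hD _ he a (by simp))]
        exact Submodule.zero_mem _
      · have h1 : freeVertexBoundary S D Y (Pi.single ⟨s(a, b), hab, he⟩ 1) ∈
          LinearMap.range (freeVertexBoundary S D Y) := ⟨_, rfl⟩
        convert Submodule.add_mem _ hb h1 using 1
        ext u
        have hne := Tri.ne_of_adj hab
        simp only [freeVertexBoundary, LinearMap.coe_mk, AddHom.coe_mk, Pi.add_apply,
          Finset.sum_pi_single', Finset.mem_filter, Finset.mem_univ, true_and, Sym2.mem_iff]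
        by_cases h1 : u.1 = a
        · have : u.1 ≠ b := h1 ▸ hne
          simp [h1, hne]
        · by_cases h2 : u.1 = b
          · simpa [h2, hne.symm] using (CharTwo.add_self_eq_zero (1 : ZMod 2)).symm
          · simp [h1, h2]
  rw [← LinearMap.range_eq_top, eq_top_iff]
  rintro g -
  have hg : g = ∑ x : {x : X // x ∉ Y}, g x •
      (fun u : {x : X // x ∉ Y} => if u.1 = x.1 then (1 : ZMod 2) else 0) := by
    ext u
    rw [Finset.sum_apply, Finset.sum_eq_single u]
    · simp
    · intro b _ hb
      have : u.1 ≠ b.1 := fun h => hb (Subtype.ext h.symm)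
      simp [this]
    · simp
  rw [hg]
  exact Submodule.sum_mem _ fun x _ => Submodule.smul_mem _ _ (key x.1)

/-- Euler's inequality for a graph with vertex set `Y` and edge set `D` drawn on the surface. -/
theorem eulerChar_le (hDS : D ⊆ S.skeleton.edgeSet) (hD : ∀ e ∈ D, ∀ x ∈ e, x ∈ Y)
    (hY : Y.Nonempty) :
    S.eulerChar ≤ (Y.ncard : ℤ) - D.ncard + Nat.card (S.cutGraph D).ConnectedComponent := by
  have h1 := LinearMap.finrank_range_add_finrank_ker (freeBoundary S D)
  have h2 := LinearMap.finrank_range_add_finrank_ker (freeVertexBoundary S D Y)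
  rw [LinearMap.range_eq_top.2 (freeVertexBoundary_surjective hD hY), finrank_top] at h2
  rw [LinearEquiv.finrank_eq kerFreeBoundaryEquiv] at h1
  have h3 := Submodule.finrank_mono (range_freeBoundary_le (S := S) hD)
  simp only [Module.finrank_fintype_fun_eq_card] at h1 h2
  have h4 : Fintype.card S.Tri = S.triangles.card := Fintype.card_coe _
  have h5 : Fintype.card (S.FreeEdge D) + D.ncard = S.skeleton.edgeSet.ncard := by
    rw [← Nat.card_eq_fintype_card, ← Set.ncard_sdiff_add_ncard_of_subset hDS]
    rfl
  have h6 : Fintype.card {x : X // x ∉ Y} + Y.ncard = Fintype.card X := by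
    rw [← Nat.card_eq_fintype_card (α := X), ← Set.ncard_add_ncard_compl Y,
      ← Nat.card_eq_fintype_card, add_comm]
    rfl
  -- The dimension count: triangles minus faces is the rank of the first boundary map, which is at
  -- most the dimension of the kernel of the second, namely free edges minus free points.
  rw [Nat.card_eq_fintype_card, eulerChar]
  omega

theorem eulerGenus_nonneg : 0 ≤ S.eulerGenus := by
  obtain ⟨x⟩ := S.connected.nonempty
  -- For a graph that is one point the inequality reads $\chi \le 1 - 0 + 1$.
  have h := eulerChar_le (S := S) (D := ∅) (Y := {x}) (by simp) (by simp) (by simp)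
  have h1 : Nat.card (S.cutGraph ∅).ConnectedComponent ≤ 1 := by
    have : Subsingleton (S.cutGraph ∅).ConnectedComponent := by
      refine ⟨fun a b => ?_⟩
      induction a using SimpleGraph.ConnectedComponent.ind with | _ σ
      induction b using SimpleGraph.ConnectedComponent.ind with | _ τ
      refine SimpleGraph.ConnectedComponent.sound ?_
      refine mem_of_closed {ρ | (S.cutGraph ∅).Reachable σ ρ} ?_ (σ := σ) (by simp) τ
      intro x y hxy π ρ h1 h2 h3 h4 h5
      by_cases h : π = ρ
      · exact h ▸ h5
      · exact SimpleGraph.Reachable.trans h5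
          (SimpleGraph.Adj.reachable ⟨h, x, y, hxy, ⟨h1, h2⟩, ⟨h3, h4⟩, by simp⟩)
    exact Finite.card_le_one_iff_subsingleton.2 this
  simp only [Set.ncard_singleton, Set.ncard_empty] at h
  rw [eulerGenus]
  omega

end Euler
end ClosedSurface

/-! ### Faces of a drawing: sides of edges, parity, boundary length. -/

namespace Drawing

open ClosedSurface

section Faces

open Classical

variable {X V : Type*} [Fintype X] [DecidableEq X] {G : SimpleGraph V} {S : ClosedSurface X}
  {D : Drawing G S}

/-- The face that contains a triangle. -/
def faceOf (D : Drawing G S) (τ : S.Tri) : D.Face := (S.cutGraph D.edges).connectedComponentMk τ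

theorem Face.mem_triangles {f : D.Face} {τ : S.Tri} : τ ∈ f.triangles ↔ D.faceOf τ = f :=
  SimpleGraph.ConnectedComponent.mem_supp_iff _ _

theorem exists_faceOf_eq (f : D.Face) : ∃ τ, D.faceOf τ = f :=
  SimpleGraph.ConnectedComponent.ind (fun τ => ⟨τ, rfl⟩) f

theorem adj_skeleton {v w : V} (h : G.Adj v w) : S.skeleton.Adj (D v) (D w) := D.toHom.map_adj h

theorem exists_of_mem_edges {x y : X} (h : s(x, y) ∈ D.edges) :
    ∃ v w, G.Adj v w ∧ D v = x ∧ D w = y := by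
  obtain ⟨e, he, h⟩ := h
  induction e with
  | _ v w =>
  rw [Sym2.map_mk, Sym2.eq_iff] at h
  rcases h with h | h
  · exact ⟨v, w, he, h.1, h.2⟩
  · exact ⟨w, v, SimpleGraph.Adj.symm he, h.2, h.1⟩

theorem faceOf_eq {x y : X} (hxy : x ≠ y) {σ τ : S.Tri} (h1 : x ∈ σ.1) (h2 : y ∈ σ.1)
    (h3 : x ∈ τ.1) (h4 : y ∈ τ.1) (h : s(x, y) ∉ D.edges) : D.faceOf σ = D.faceOf τ := by
  by_cases hne : σ = τ
  · rw [hne]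
  · exact SimpleGraph.ConnectedComponent.sound
      (SimpleGraph.Adj.reachable ⟨hne, x, y, hxy, ⟨h1, h2⟩, ⟨h3, h4⟩, h⟩)

/-- A function on triangles that only changes across edges of the drawing is constant on faces. -/
theorem eq_of_faceOf_eq {M : Type*} {F : S.Tri → M}
    (hF : ∀ σ τ, (S.cutGraph D.edges).Adj σ τ → F σ = F τ) {σ τ : S.Tri}
    (h : D.faceOf σ = D.faceOf τ) : F σ = F τ :=
  eq_of_reachable hF (SimpleGraph.ConnectedComponent.exact h)

/-- The number of sides of the edge `e` that lie in the face `f`. -/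
noncomputable def Face.sideCount (f : D.Face) (e : Sym2 V) : ℕ :=
  (Finset.univ.filter fun τ : S.Tri => (∀ v ∈ e, D v ∈ τ.1) ∧ D.faceOf τ = f).card

theorem sideCount_eq (f : D.Face) {v w : V} {σ τ : S.Tri} (hne : σ ≠ τ)
    (hs : (Finset.univ.filter fun ρ : S.Tri => D v ∈ ρ.1 ∧ D w ∈ ρ.1) = {σ, τ}) :
    f.sideCount s(v, w) = (if D.faceOf σ = f then 1 else 0) + if D.faceOf τ = f then 1 else 0 := by
  rw [Face.sideCount, ← Finset.filter_filter, Finset.card_filter]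
  simp only [Sym2.ball]
  rw [hs, Finset.sum_pair hne]

theorem sideCount_pos {f : D.Face} {e : Sym2 V} :
    0 < f.sideCount e ↔ ∃ τ, D.faceOf τ = f ∧ ∀ v ∈ e, D v ∈ τ.1 := by
  rw [Face.sideCount, Finset.card_pos]
  simp [Finset.Nonempty, and_comm]

theorem sideCount_mk_pos {f : D.Face} {τ : S.Tri} (h : D.faceOf τ = f) {v w : V}
    (hv : D v ∈ τ.1) (hw : D w ∈ τ.1) : 0 < f.sideCount s(v, w) :=
  sideCount_pos.2 ⟨τ, h, by simp [hv, hw]⟩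

theorem incidentEdge_iff {f : D.Face} {e : Sym2 V} :
    f.IncidentEdge e ↔ e ∈ G.edgeSet ∧ 0 < f.sideCount e := by
  rw [sideCount_pos]
  simp only [Face.IncidentEdge, Face.mem_triangles]

theorem sideCount_le_two (f : D.Face) {v w : V} (h : G.Adj v w) : f.sideCount s(v, w) ≤ 2 := by
  obtain ⟨σ, τ, hne, hs⟩ := exists_sides (adj_skeleton (D := D) h)
  rw [sideCount_eq f hne hs]
  split_ifs <;> omega

theorem faceOf_eq_of_sideCount_eq_two {f : D.Face} {v w : V} (h : G.Adj v w)
    (h2 : f.sideCount s(v, w) = 2) {τ : S.Tri} (h3 : D v ∈ τ.1) (h4 : D w ∈ τ.1) :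
    D.faceOf τ = f := by
  obtain ⟨σ, hne, hs⟩ := exists_other_side (adj_skeleton (D := D) h).1 h3 h4
  rw [sideCount_eq f hne hs] at h2
  by_contra h
  rw [if_neg h] at h2
  split_ifs at h2 <;> omega

/-- If no edge at `v` had a side in `f`, the face would spread over the whole star of `v`, including
the triangles at `vw`. -/
theorem exists_incident_edge {f : D.Face} {v w : V} (hvw : G.Adj v w) (hf : f.IncidentVertex v) :
    ∃ w, G.Adj v w ∧ 0 < f.sideCount s(v, w) := by
  by_contra! hcon
  obtain ⟨σ, hσ, hv⟩ := hf
  obtain ⟨τ, h1, h2⟩ := exists_tri_of_adj (adj_skeleton (D := D) hvw)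
  have : τ ∈ {ρ | D.faceOf ρ = f} := by
    refine mem_of_star_closed _ ?_ hv h1 (Face.mem_triangles.1 hσ)
    intro y hy π ρ h1 h2 h3 h4 h5
    by_cases he : s(D v, y) ∈ D.edges
    · obtain ⟨v', w', h6, h7, rfl⟩ := exists_of_mem_edges he
      rw [D.injective h7] at h6
      exact absurd (sideCount_mk_pos h5 h1 h2) (Nat.not_lt.2 (hcon _ h6))
    · exact (faceOf_eq hy h1 h2 h3 h4 he).symm.trans h5
  exact absurd (sideCount_mk_pos this h1 h2) (Nat.not_lt.2 (hcon _ hvw))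

theorem incidentVertex_of_sideCount_pos {f : D.Face} {e : Sym2 V} (h : 0 < f.sideCount e) {v : V}
    (hv : v ∈ e) : f.IncidentVertex v := by
  obtain ⟨τ, h1, h2⟩ := sideCount_pos.1 h
  exact ⟨τ, Face.mem_triangles.2 h1, h2 v hv⟩

variable [Fintype V]

/-- This is `star_sum_eq_zero` for the indicator of `f`; an edge of the triangulation outside the
drawing has both sides in the same face and contributes 0. -/
theorem sum_sideCount_eq_zero (f : D.Face) (v : V) :
    ∑ w : V with G.Adj v w, (f.sideCount s(v, w) : ZMod 2) = 0 := by
  rw [← star_sum_eq_zero (fun τ : S.Tri => if D.faceOf τ = f then (1 : ZMod 2) else 0) (D v)]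
  rw [← Finset.sum_subset
    (s₁ := (Finset.univ.filter fun w => G.Adj v w).map ⟨D, D.injective⟩)]
  · rw [Finset.sum_map]
    refine Finset.sum_congr rfl fun w _ => ?_
    rw [Face.sideCount, ← Finset.filter_filter, Finset.card_filter]
    push_cast
    simp only [Sym2.ball]
    rfl
  · intro x hx
    simp only [Finset.mem_map, Finset.mem_filter, Finset.mem_univ, true_and] at hx ⊢
    obtain ⟨w, hw, rfl⟩ := hx
    exact (adj_skeleton hw).1
  · intro y hy hn
    simp only [Finset.mem_filter, Finset.mem_univ, true_and] at hy
    by_cases hs : S.skeleton.Adj (D v) y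
    · obtain ⟨σ, τ, hne, he⟩ := exists_sides hs
      rw [sum_sides _ hne he]
      have hm : ∀ ρ, ρ ∈ ({σ, τ} : Finset S.Tri) → D v ∈ ρ.1 ∧ y ∈ ρ.1 := fun ρ hρ => by
        rw [← he] at hρ; simpa using hρ
      have hD : s(D v, y) ∉ D.edges := by
        intro h
        obtain ⟨v', w, h1, h2, h3⟩ := exists_of_mem_edges h
        rw [D.injective h2] at h1
        exact hn (Finset.mem_map.2 ⟨w, by simp [h1], h3⟩)
      have h1 := hm σ (by simp)
      have h2 := hm τ (by simp)
      rw [faceOf_eq hy h1.1 h1.2 h2.1 h2.2 hD]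
      exact CharTwo.add_self_eq_zero _
    · refine Finset.sum_eq_zero fun τ hτ => ?_
      simp only [Finset.mem_filter, Finset.mem_univ, true_and] at hτ
      exact absurd (Tri.adj hy hτ.1 hτ.2) hs

/-- The edge `vw` has exactly one side in the face `f`. -/
def Face.OddAdj (f : D.Face) (v w : V) : Prop := G.Adj v w ∧ f.sideCount s(v, w) = 1

omit [Fintype V] in
theorem Face.OddAdj.symm {f : D.Face} {v w : V} (h : f.OddAdj v w) : f.OddAdj w v :=
  ⟨h.1.symm, by rw [Sym2.eq_swap]; exact h.2⟩

/-- By parity the number of odd edges at `v` is even. Walking along odd edges therefore never gets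
stuck, which is how cycles in face boundaries arise. -/
theorem Face.OddAdj.exists_ne {f : D.Face} {v w : V} (h : f.OddAdj v w) :
    ∃ w', w' ≠ w ∧ f.OddAdj v w' := by
  by_contra! hcon
  have h0 := sum_sideCount_eq_zero f v
  rw [Finset.sum_eq_single w, h.2] at h0
  · simp at h0
  · intro w' hw' hne
    simp only [Finset.mem_filter, Finset.mem_univ, true_and] at hw'
    have h1 := sideCount_le_two f hw'
    have h2 : f.sideCount s(v, w') ≠ 1 := fun h => hcon w' hne ⟨hw', h⟩
    have h3 : f.sideCount s(v, w') = 0 ∨ f.sideCount s(v, w') = 2 := by omega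
    rcases h3 with h3 | h3 <;> rw [h3]
    · simp
    · rfl
  · intro hn
    simp [h.1] at hn

omit [Fintype V] in
/-- A face without odd edges is the whole complement of the graph. -/
theorem faceOf_eq_of_forall_not_oddAdj {f : D.Face} (hf : ∀ v w, ¬ f.OddAdj v w) (τ : S.Tri) :
    D.faceOf τ = f := by
  obtain ⟨σ, hσ⟩ := exists_faceOf_eq f
  refine mem_of_closed {ρ | D.faceOf ρ = f} ?_ hσ τ
  intro x y hxy π ρ h1 h2 h3 h4 h5
  by_cases he : s(x, y) ∈ D.edges
  · obtain ⟨v, w, h6, rfl, rfl⟩ := exists_of_mem_edges he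
    have h7 := sideCount_mk_pos h5 h1 h2
    have h8 := sideCount_le_two f h6
    have h9 : f.sideCount s(v, w) ≠ 1 := fun h => hf v w ⟨h6, h⟩
    exact faceOf_eq_of_sideCount_eq_two h6 (by omega) h3 h4
  · exact (faceOf_eq hxy h1 h2 h3 h4 he).symm.trans h5

noncomputable instance : Fintype D.Face :=
  inferInstanceAs (Fintype (S.cutGraph D.edges).ConnectedComponent)

omit [Fintype V] in
theorem sum_sideCount {e : Sym2 V} (he : e ∈ G.edgeSet) : ∑ f : D.Face, f.sideCount e = 2 := by
  induction e with
  | _ v w =>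
  obtain ⟨σ, τ, hne, hs⟩ := exists_sides (adj_skeleton (D := D) he)
  simp only [sideCount_eq _ hne hs, Finset.sum_add_distrib, Finset.sum_ite_eq,
    Finset.mem_univ, if_true]

/-- The length of the boundary of a face: edges with both sides in the face count twice. -/
noncomputable def Face.length (f : D.Face) : ℕ := ∑ e ∈ G.edgeFinset, f.sideCount e

theorem sum_length : ∑ f : D.Face, f.length = 2 * G.edgeFinset.card := by
  simp only [Face.length]
  rw [Finset.sum_comm, Finset.sum_congr rfl fun e he =>
    sum_sideCount (SimpleGraph.mem_edgeFinset.1 he)]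
  simp [mul_comm]

theorem length_eq_of_forall_not_oddAdj {f : D.Face} (hf : ∀ v w, ¬ f.OddAdj v w) :
    f.length = 2 * G.edgeFinset.card := by
  rw [← sum_length (D := D), Finset.sum_eq_single f]
  · intro g _ hg
    obtain ⟨τ, rfl⟩ := exists_faceOf_eq g
    exact absurd (faceOf_eq_of_forall_not_oddAdj hf τ) hg
  · simp

/-- A set of `k` odd edges bounds the length from below; in case of equality there are no other
edges on the boundary. -/
theorem Face.card_le_length {f : D.Face} {A : Finset (Sym2 V)} (hA : ∀ e ∈ A, e ∈ G.edgeSet)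
    (h1 : ∀ e ∈ A, f.sideCount e = 1) : A.card ≤ f.length := by
  rw [Finset.card_eq_sum_ones, Face.length, ← Finset.sum_congr rfl h1]
  exact Finset.sum_le_sum_of_subset fun e he => SimpleGraph.mem_edgeFinset.2 (hA e he)

theorem Face.mem_of_card_eq_length {f : D.Face} {A : Finset (Sym2 V)}
    (hA : ∀ e ∈ A, e ∈ G.edgeSet) (h1 : ∀ e ∈ A, f.sideCount e = 1) (hl : A.card = f.length)
    {e : Sym2 V} (he : e ∈ G.edgeSet) (hpos : 0 < f.sideCount e) : e ∈ A := by
  by_contra hn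
  have h2 := Finset.sum_le_sum_of_subset (f := f.sideCount) (s := insert e A)
    (t := G.edgeFinset) fun e' he' => by
      rw [SimpleGraph.mem_edgeFinset]
      rcases Finset.mem_insert.1 he' with rfl | h
      · exact he
      · exact hA _ h
  rw [Finset.sum_insert hn, Finset.sum_congr rfl h1, ← Finset.card_eq_sum_ones, hl] at h2
  simp only [Face.length] at h2
  omega

end Faces
end Drawing

/-! ### Closed walks of length three and four. -/

namespace SimpleGraph

variable {V : Type*} {G : SimpleGraph V}

/-- The closed walk around a triangle. -/
def triangleWalk {u a b : V} (h1 : G.Adj u a) (h2 : G.Adj a b) (h3 : G.Adj b u) : G.Walk u u :=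
  .cons h1 (.cons h2 (.cons h3 .nil))

theorem isCycle_triangleWalk {u a b : V} (h1 : G.Adj u a) (h2 : G.Adj a b) (h3 : G.Adj b u) :
    (triangleWalk h1 h2 h3).IsCycle := by
  have := h1.ne
  have := h2.ne
  have := h3.ne
  rw [triangleWalk, Walk.cons_isCycle_iff]
  simp [Walk.isPath_def]
  grind

/-- The closed walk around a quadrangle. -/
def quadrangleWalk {u a b c : V} (h1 : G.Adj u a) (h2 : G.Adj a b) (h3 : G.Adj b c)
    (h4 : G.Adj c u) : G.Walk u u :=
  .cons h1 (.cons h2 (.cons h3 (.cons h4 .nil)))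

theorem isCycle_quadrangleWalk {u a b c : V} (h1 : G.Adj u a) (h2 : G.Adj a b) (h3 : G.Adj b c)
    (h4 : G.Adj c u) (hub : u ≠ b) (hac : a ≠ c) : (quadrangleWalk h1 h2 h3 h4).IsCycle := by
  have := h1.ne
  have := h2.ne
  have := h3.ne
  have := h4.ne
  rw [quadrangleWalk, Walk.cons_isCycle_iff]
  simp [Walk.isPath_def]
  grind

theorem not_adj_of_four_le_egirth (h : 4 ≤ G.egirth) {u a b : V} (h1 : G.Adj u a)
    (h2 : G.Adj a b) : ¬ G.Adj b u := by
  intro h3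
  have := le_egirth.1 h u _ (isCycle_triangleWalk h1 h2 h3)
  simp only [triangleWalk, Walk.length_cons, Walk.length_nil] at this
  norm_num at this

end SimpleGraph

/-! ### Every face has length at least $t$, and faces of length $t$ are bounded by cycles. -/

namespace Drawing

open ClosedSurface

section Faces

open Classical

variable {X V : Type*} [Fintype X] [DecidableEq X] {G : SimpleGraph V} {S : ClosedSurface X}
  {D : Drawing G S} [Fintype V]

theorem three_le_length {f : D.Face} {u a : V} (h : f.OddAdj u a) : 3 ≤ f.length ∧
    (f.length = 3 → ∃ b, f.OddAdj u b ∧ f.OddAdj a b ∧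
      ∀ e ∈ G.edgeSet, 0 < f.sideCount e → e = s(u, a) ∨ e = s(u, b) ∨ e = s(a, b)) := by
  obtain ⟨b, hba, hb⟩ := h.exists_ne
  obtain ⟨c, hcu, hc⟩ := h.symm.exists_ne
  obtain ⟨d, hdu, hd⟩ := hb.symm.exists_ne
  have hua := h.1.ne
  have hub := hb.1.ne
  have hac := hc.1.ne
  have hbd := hd.1.ne
  have hc3 : ({s(u, a), s(u, b), s(a, c)} : Finset (Sym2 V)).card = 3 := by
    refine Finset.card_eq_three.2 ⟨_, _, _, ?_, ?_, ?_, rfl⟩ <;> simp only [ne_eq, Sym2.eq_iff] <;>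
      grind
  have hA : ∀ e ∈ ({s(u, a), s(u, b), s(a, c)} : Finset (Sym2 V)), e ∈ G.edgeSet := by
    simp only [Finset.mem_insert, Finset.mem_singleton, forall_eq_or_imp, forall_eq]
    exact ⟨h.1, hb.1, hc.1⟩
  have h1 : ∀ e ∈ ({s(u, a), s(u, b), s(a, c)} : Finset (Sym2 V)), f.sideCount e = 1 := by
    simp only [Finset.mem_insert, Finset.mem_singleton, forall_eq_or_imp, forall_eq]
    exact ⟨h.2, hb.2, hc.2⟩
  refine ⟨hc3 ▸ Face.card_le_length hA h1, fun hl => ?_⟩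
  have key := fun {e} => Face.mem_of_card_eq_length (e := e) hA h1 (hc3.trans hl.symm)
  simp only [Finset.mem_insert, Finset.mem_singleton] at key
  -- The three odd edges found exhaust the length, so the odd edge `bd` with `d ≠ u` is one of them;
  -- only `ac` is possible.
  have hcb : c = b := by
    have := key (e := s(b, d)) hd.1 (by rw [hd.2]; exact one_pos)
    simp only [Sym2.eq_iff] at this
    grind
  subst hcb
  exact ⟨c, hb, hc, fun e h1 h2 => key h1 h2⟩

theorem four_le_length (hG : 4 ≤ G.egirth) {f : D.Face} {u a : V} (h : f.OddAdj u a) :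
    4 ≤ f.length ∧ (f.length = 4 → ∃ b c, f.OddAdj u b ∧ f.OddAdj a c ∧ f.OddAdj b c ∧ a ≠ b ∧
      u ≠ c ∧ ∀ e ∈ G.edgeSet, 0 < f.sideCount e →
        e = s(u, a) ∨ e = s(u, b) ∨ e = s(a, c) ∨ e = s(b, c)) := by
  obtain ⟨b, hba, hb⟩ := h.exists_ne
  obtain ⟨c, hcu, hc⟩ := h.symm.exists_ne
  obtain ⟨d, hdu, hd⟩ := hb.symm.exists_ne
  obtain ⟨g, hga, hg⟩ := hc.symm.exists_ne
  have hua := h.1.ne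
  have hub := hb.1.ne
  have hac := hc.1.ne
  have hbd := hd.1.ne
  have hcg := hg.1.ne
  have hcb : c ≠ b := by
    rintro rfl
    exact SimpleGraph.not_adj_of_four_le_egirth hG h.1 hc.1 hb.1.symm
  have hda : d ≠ a := by
    rintro rfl
    exact SimpleGraph.not_adj_of_four_le_egirth hG hb.1 hd.1 h.1.symm
  have hc4 : ({s(u, a), s(u, b), s(a, c), s(b, d)} : Finset (Sym2 V)).card = 4 := by
    rw [Finset.card_insert_of_notMem, Finset.card_eq_three.2 ⟨_, _, _, ?_, ?_, ?_, rfl⟩] <;>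
      simp only [ne_eq, Finset.mem_insert, Finset.mem_singleton, Sym2.eq_iff] <;> grind
  have hA : ∀ e ∈ ({s(u, a), s(u, b), s(a, c), s(b, d)} : Finset (Sym2 V)), e ∈ G.edgeSet := by
    simp only [Finset.mem_insert, Finset.mem_singleton, forall_eq_or_imp, forall_eq]
    exact ⟨h.1, hb.1, hc.1, hd.1⟩
  have h1 : ∀ e ∈ ({s(u, a), s(u, b), s(a, c), s(b, d)} : Finset (Sym2 V)),
      f.sideCount e = 1 := by
    simp only [Finset.mem_insert, Finset.mem_singleton, forall_eq_or_imp, forall_eq]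
    exact ⟨h.2, hb.2, hc.2, hd.2⟩
  refine ⟨hc4 ▸ Face.card_le_length hA h1, fun hl => ?_⟩
  have key := fun {e} => Face.mem_of_card_eq_length (e := e) hA h1 (hc4.trans hl.symm)
  simp only [Finset.mem_insert, Finset.mem_singleton] at key
  -- The odd edge `cg` with `g ≠ a` must be among the four edges found, hence equals `bd`.
  have hcd : c = d := by
    have := key (e := s(c, g)) hg.1 (by rw [hg.2]; exact one_pos)
    simp only [Sym2.eq_iff] at this
    grind
  subst hcd
  exact ⟨b, c, hb, hc, hd, hba.symm, hcu.symm, fun e h1 h2 => key h1 h2⟩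

/-- Such a face contains both sides of every edge, and minimum degree two provides at least three
edges, so the length is at least six. -/
theorem four_lt_length {f : D.Face} [Nonempty V] (hdeg : ∀ v, 2 ≤ G.degree v)
    (hf : ∀ v w, ¬ f.OddAdj v w) : 4 < f.length := by
  have hother : ∀ v w, ∃ x, x ≠ w ∧ G.Adj v x := by
    intro v w
    have : 1 < (G.neighborFinset v).card := lt_of_lt_of_le one_lt_two (hdeg v)
    obtain ⟨x, hx, hne⟩ := Finset.exists_mem_ne this w
    exact ⟨x, hne, by simpa using hx⟩
  obtain ⟨u⟩ := ‹Nonempty V›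
  obtain ⟨a, -, ha⟩ := hother u u
  obtain ⟨b, hba, hb⟩ := hother u a
  obtain ⟨c, hcu, hc⟩ := hother a u
  have hua := ha.ne
  have hub := hb.ne
  have hac := hc.ne
  have hc3 : ({s(u, a), s(u, b), s(a, c)} : Finset (Sym2 V)).card = 3 := by
    refine Finset.card_eq_three.2 ⟨_, _, _, ?_, ?_, ?_, rfl⟩ <;> simp only [ne_eq, Sym2.eq_iff] <;>
      grind
  have h3 : ({s(u, a), s(u, b), s(a, c)} : Finset (Sym2 V)) ⊆ G.edgeFinset := by
    intro e
    simp only [Finset.mem_insert, Finset.mem_singleton, SimpleGraph.mem_edgeFinset]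
    rintro (rfl | rfl | rfl)
    exacts [ha, hb, hc]
  have := Finset.card_le_card h3
  rw [length_eq_of_forall_not_oddAdj hf]
  omega

theorem le_length {t : ℕ} [Nonempty V] (hdeg : ∀ v, 2 ≤ G.degree v)
    (ht : t = 3 ∨ t = 4 ∧ 4 ≤ G.egirth) (f : D.Face) : t ≤ f.length := by
  by_cases hf : ∀ v w, ¬ f.OddAdj v w
  · have := four_lt_length hdeg hf
    omega
  · push Not at hf
    obtain ⟨v, w, h⟩ := hf
    rcases ht with rfl | ⟨rfl, hG⟩
    exacts [(three_le_length h).1, (four_le_length hG h).1]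

theorem exists_oddAdj_of_length_le [Nonempty V] (hdeg : ∀ v, 2 ≤ G.degree v) {f : D.Face}
    (hf : f.length ≤ 4) : ∃ v w, f.OddAdj v w := by
  by_contra! h
  exact absurd (four_lt_length hdeg h) (by omega)

theorem exists_triangle_of_length_eq [Nonempty V] (hdeg : ∀ v, 2 ≤ G.degree v) {f : D.Face}
    (hf : f.length = 3) {u a : V} (hua : G.Adj u a) (hpos : 0 < f.sideCount s(u, a)) :
    f.OddAdj u a ∧ ∃ b, f.OddAdj u b ∧ f.OddAdj a b ∧
      ∀ e ∈ G.edgeSet, 0 < f.sideCount e → e = s(u, a) ∨ e = s(u, b) ∨ e = s(a, b) := by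
  have h : f.OddAdj u a := by
    obtain ⟨v, w, h⟩ := exists_oddAdj_of_length_le hdeg (f := f) (by omega)
    obtain ⟨b, h1, h2, h3⟩ := (three_le_length h).2 hf
    refine ⟨hua, ?_⟩
    rcases h3 _ hua hpos with h4 | h4 | h4 <;> rw [h4]
    exacts [h.2, h1.2, h2.2]
  exact ⟨h, (three_le_length h).2 hf⟩

theorem exists_quadrangle_of_length_eq [Nonempty V] (hdeg : ∀ v, 2 ≤ G.degree v)
    (hG : 4 ≤ G.egirth) {f : D.Face} (hf : f.length = 4) {u a : V} (hua : G.Adj u a)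
    (hpos : 0 < f.sideCount s(u, a)) :
    f.OddAdj u a ∧ ∃ b c, f.OddAdj u b ∧ f.OddAdj a c ∧ f.OddAdj b c ∧ a ≠ b ∧
      u ≠ c ∧ ∀ e ∈ G.edgeSet, 0 < f.sideCount e →
        e = s(u, a) ∨ e = s(u, b) ∨ e = s(a, c) ∨ e = s(b, c) := by
  have h : f.OddAdj u a := by
    obtain ⟨v, w, h⟩ := exists_oddAdj_of_length_le hdeg (f := f) (by omega)
    obtain ⟨b, c, h1, h2, h3, -, -, h4⟩ := (four_le_length hG h).2 hf
    refine ⟨hua, ?_⟩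
    rcases h4 _ hua hpos with h5 | h5 | h5 | h5 <;> rw [h5]
    exacts [h.2, h1.2, h2.2, h3.2]
  exact ⟨h, (four_le_length hG h).2 hf⟩

omit [Fintype V] in
theorem isBoundedByCycle_of_walk (hdeg : ∀ v, ∃ w, G.Adj v w) {f : D.Face} {v : V}
    (C : G.Walk v v) (hC : C.IsCycle)
    (h : ∀ e ∈ G.edgeSet, 0 < f.sideCount e ↔ e ∈ C.edges) : f.IsBoundedByCycle C.length := by
  refine ⟨v, C, hC, rfl, fun u => ?_, fun e => ?_⟩
  · rw [SimpleGraph.Walk.mem_support_iff_exists_mem_edges_of_not_nil hC.not_nil]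
    constructor
    · intro hu
      obtain ⟨w, hw⟩ := hdeg u
      obtain ⟨x, hx, hpos⟩ := exists_incident_edge hw hu
      exact ⟨_, (h _ hx).1 hpos, by simp⟩
    · rintro ⟨e, he, hu⟩
      exact incidentVertex_of_sideCount_pos ((h e (C.edges_subset_edgeSet he)).2 he) hu
  · rw [incidentEdge_iff]
    exact ⟨fun he => (h e he.1).1 he.2, fun he => ⟨C.edges_subset_edgeSet he,
      (h e (C.edges_subset_edgeSet he)).2 he⟩⟩

theorem isBoundedByCycle_of_length_eq {t : ℕ} [Nonempty V] (hdeg : ∀ v, 2 ≤ G.degree v)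
    (ht : t = 3 ∨ t = 4 ∧ 4 ≤ G.egirth) {f : D.Face} (hf : f.length = t) :
    f.IsBoundedByCycle t := by
  have hex : ∀ v, ∃ w, G.Adj v w := fun v => by
    have : 0 < (G.neighborFinset v).card := lt_of_lt_of_le two_pos (hdeg v)
    obtain ⟨x, hx⟩ := Finset.card_pos.1 this
    exact ⟨x, by simpa using hx⟩
  obtain ⟨v, w, h⟩ := exists_oddAdj_of_length_le hdeg (f := f) (by omega)
  rcases ht with rfl | ⟨rfl, hG⟩
  · obtain ⟨b, h1, h2, h3⟩ := (three_le_length h).2 hf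
    refine isBoundedByCycle_of_walk hex _ (SimpleGraph.isCycle_triangleWalk h.1 h2.1 h1.1.symm)
      fun e he => ⟨fun hpos => ?_, fun hm => ?_⟩
    · rcases h3 e he hpos with rfl | rfl | rfl <;> simp [SimpleGraph.triangleWalk]
    · simp only [SimpleGraph.triangleWalk, SimpleGraph.Walk.edges_cons,
        SimpleGraph.Walk.edges_nil, List.mem_cons, List.not_mem_nil, or_false] at hm
      rcases hm with rfl | rfl | rfl
      · rw [h.2]; exact one_pos
      · rw [h2.2]; exact one_pos
      · rw [h1.symm.2]; exact one_pos
  · obtain ⟨b, c, h1, h2, h3, h4, h5, h6⟩ := (four_le_length hG h).2 hf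
    refine isBoundedByCycle_of_walk hex _
      (SimpleGraph.isCycle_quadrangleWalk h.1 h2.1 h3.1.symm h1.1.symm h5 h4)
      fun e he => ⟨fun hpos => ?_, fun hm => ?_⟩
    · rcases h6 e he hpos with rfl | rfl | rfl | rfl <;> simp [SimpleGraph.quadrangleWalk]
    · simp only [SimpleGraph.quadrangleWalk, SimpleGraph.Walk.edges_cons,
        SimpleGraph.Walk.edges_nil, List.mem_cons, List.not_mem_nil, or_false] at hm
      rcases hm with rfl | rfl | rfl | rfl
      · rw [h.2]; exact one_pos
      · rw [h2.2]; exact one_pos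
      · rw [h3.symm.2]; exact one_pos
      · rw [h1.symm.2]; exact one_pos

end Faces
end Drawing

/-! ### Homotopic paths are homologous modulo 2. -/

namespace ClosedSurface

variable {X : Type*} [Fintype X] [DecidableEq X] {S : ClosedSurface X}

/-- The 1-chain modulo 2 of an edge path. -/
def edgeChain : List X → Sym2 X → ZMod 2
  | x :: y :: l => fun e => (if e = s(x, y) then 1 else 0) + edgeChain (y :: l) e
  | _ => 0

omit [Fintype X] in
theorem edgeChain_append (l r : List X) (x : X) :
    edgeChain (l ++ x :: r) = edgeChain (l ++ [x]) + edgeChain (x :: r) := by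
  induction l with
  | nil => ext; simp [edgeChain]
  | cons a l ih =>
    cases l with
    | nil => ext; simp [edgeChain]
    | cons b l =>
      ext e
      have := congrFun ih e
      simp only [List.cons_append, Pi.add_apply] at this
      simp only [List.cons_append, edgeChain, Pi.add_apply, this]
      ring

/-- Homotopic edge paths differ by the boundary of a 2-chain modulo 2. -/
theorem PathHomotopic.exists_boundary {l l' : List X} (h : S.PathHomotopic l l') :
    ∃ F : S.Tri → ZMod 2, ∀ p q, p ≠ q →
      ∑ τ : S.Tri with p ∈ τ.1 ∧ q ∈ τ.1, F τ = edgeChain l s(p, q) + edgeChain l' s(p, q) := by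
  induction h with
  | rel l l' h =>
    cases h with
    | backtrack l r x y h =>
      -- The two traversals of `xy` cancel modulo 2.
      refine ⟨0, fun p q _ => ?_⟩
      rw [edgeChain_append l (y :: x :: r), edgeChain_append l r]
      simp only [edgeChain, Pi.add_apply, Pi.zero_apply, Finset.sum_const_zero,
        Sym2.eq_swap (a := y) (b := x)]
      grind
    | triangle l r x y z h =>
      -- The two chains differ by the boundary of the triangle `xyz` itself.
      refine ⟨Pi.single ⟨_, h⟩ 1, fun p q hpq => ?_⟩
      rw [edgeChain_append l (y :: z :: r), edgeChain_append l (z :: r)]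
      have hd : x ≠ y ∧ x ≠ z ∧ y ≠ z := by
        have h3 := S.card_triangle _ h
        refine ⟨?_, ?_, ?_⟩ <;> rintro rfl
        · have := Finset.card_le_two (a := x) (b := z); simp_all
        · have := Finset.card_le_two (a := x) (b := y)
          rw [Finset.pair_comm y, Finset.insert_eq_of_mem (by simp)] at h3
          omega
        · have := Finset.card_le_two (a := x) (b := y); simp_all
      obtain ⟨h1, h2, h3⟩ := hd
      rw [Finset.sum_pi_single']
      simp only [Finset.mem_filter, Finset.mem_univ, true_and, Finset.mem_insert,
        Finset.mem_singleton, edgeChain, Pi.add_apply, Sym2.eq_iff]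
      generalize edgeChain (l ++ [x]) s(p, q) = A
      generalize edgeChain (z :: r) s(p, q) = B
      have hA : A + A = 0 := CharTwo.add_self_eq_zero _
      have hB : B + B = 0 := CharTwo.add_self_eq_zero _
      have e2 : (1 : ZMod 2) + 1 = 0 := CharTwo.add_self_eq_zero _
      split_ifs <;> grind
  | refl l => exact ⟨0, fun p q _ => by simp [CharTwo.add_self_eq_zero]⟩
  | symm l l' _ ih => exact ih.imp fun F hF p q h => by rw [hF p q h, add_comm]
  | trans a b c _ _ ih1 ih2 =>
    obtain ⟨F, hF⟩ := ih1
    obtain ⟨F', hF'⟩ := ih2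
    refine ⟨F + F', fun p q h => ?_⟩
    simp only [Pi.add_apply, Finset.sum_add_distrib]
    rw [hF p q h, hF' p q h]
    have := CharTwo.add_self_eq_zero (edgeChain b s(p, q))
    linear_combination this

end ClosedSurface

/-! ### Going around a vertex, and the two sides of a contractible triangle. -/

namespace Drawing

open ClosedSurface SimpleGraph

section

variable {X V : Type*} [Fintype X] [DecidableEq X] {G : SimpleGraph V} {S : ClosedSurface X}
  {D : Drawing G S}

/-- A set of faces that, around the vertex `u`, is closed under crossing edges contains all the
faces at `u`. -/
theorem exists_sideCount_pos_of_closed {u : V} (H : Set D.Face) {f : D.Face} (hf : f ∈ H) {w₀ : V}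
    (hw₀ : 0 < f.sideCount s(u, w₀))
    (hH : ∀ f ∈ H, ∀ w, G.Adj u w → 0 < f.sideCount s(u, w) →
      ∃ g ∈ H, g ≠ f ∧ 0 < g.sideCount s(u, w)) {w : V} (hw : G.Adj u w) :
    ∃ f ∈ H, 0 < f.sideCount s(u, w) := by
  obtain ⟨σ, hσ, hσ'⟩ := sideCount_pos.1 hw₀
  obtain ⟨τ, h1, h2⟩ := exists_tri_of_adj (adj_skeleton (D := D) hw)
  have : τ ∈ {ρ | D.faceOf ρ ∈ H} := by
    refine mem_of_star_closed _ ?_ (hσ' u (by simp)) h1 (show D.faceOf σ ∈ H from hσ ▸ hf)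
    intro y hy π ρ h1 h2 h3 h4 h5
    by_cases he : s(D u, y) ∈ D.edges
    · obtain ⟨u', w', h6, h7, rfl⟩ := exists_of_mem_edges he
      rw [D.injective h7] at h6
      obtain ⟨g, hg, hne, hg'⟩ := hH _ h5 w' h6 (sideCount_mk_pos rfl h1 h2)
      obtain ⟨ρ', rfl, h8⟩ := sideCount_pos.1 hg'
      obtain ⟨π', hne', hs⟩ := exists_other_side hy h1 h2
      have hρ' : ρ' ∈ (Finset.univ.filter fun ρ : S.Tri => D u ∈ ρ.1 ∧ D w' ∈ ρ.1) := by
        simp [h8 u (by simp), h8 w' (by simp)]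
      have hρ : ρ ∈ (Finset.univ.filter fun ρ : S.Tri => D u ∈ ρ.1 ∧ D w' ∈ ρ.1) := by
        simp [h3, h4]
      rw [hs, Finset.mem_insert, Finset.mem_singleton] at hρ hρ'
      rcases hρ with rfl | rfl
      · exact h5
      · rcases hρ' with rfl | rfl
        · exact absurd rfl hne
        · exact hg
    · rw [Set.mem_ofPred_eq, ← faceOf_eq hy h1 h2 h3 h4 he]
      exact h5
  exact ⟨_, this, sideCount_mk_pos rfl h1 h2⟩

/-- A contractible non-separating triangle of `G` has an indicator function of one of its sides
that takes the same value at all vertices outside the triangle. -/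
theorem exists_side_function {u x y : V} (h1 : G.Adj u x) (h2 : G.Adj x y) (h3 : G.Adj y u)
    (hc : D.IsContractible (triangleWalk h1 h2 h3))
    (hs : ¬ D.IsSeparating (triangleWalk h1 h2 h3)) :
    ∃ F : S.Tri → ZMod 2, (∀ σ τ, D.faceOf σ = D.faceOf τ → F σ = F τ) ∧
      (∀ v w, v ≠ u → v ≠ x → v ≠ y → w ≠ u → w ≠ x → w ≠ y → ∀ σ τ : S.Tri,
        D v ∈ σ.1 → D w ∈ τ.1 → F σ = F τ) ∧
      (∀ σ τ : S.Tri, σ ≠ τ → D y ∈ σ.1 → D u ∈ σ.1 → D y ∈ τ.1 → D u ∈ τ.1 → F σ ≠ F τ) := by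
  obtain ⟨F, hF⟩ := PathHomotopic.exists_boundary hc
  have hux : D u ≠ D x := D.injective.ne h1.ne
  have hxy : D x ≠ D y := D.injective.ne h2.ne
  have hyu : D y ≠ D u := D.injective.ne h3.ne
  simp only [triangleWalk, Walk.support_cons, Walk.support_nil, List.map_cons, List.map_nil,
    edgeChain, Pi.zero_apply, add_zero] at hF
  -- The boundary of `F` is the closed walk, the chain of the constant path being 0. Hence `F` does
  -- not change across any other edge.
  have hcross : ∀ p q, p ≠ q → s(p, q) ∉ Sym2.map D '' {e | e ∈ (triangleWalk h1 h2 h3).edges} →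
      ∀ σ τ : S.Tri, p ∈ σ.1 → q ∈ σ.1 → p ∈ τ.1 → q ∈ τ.1 → F σ = F τ := by
    intro p q hpq he σ τ a1 a2 a3 a4
    obtain ⟨σ', hne, hs⟩ := exists_other_side hpq a1 a2
    have hτ : τ ∈ (Finset.univ.filter fun ρ : S.Tri => p ∈ ρ.1 ∧ q ∈ ρ.1) := by simp [a3, a4]
    have hsum := hF p q hpq
    rw [sum_sides F hne hs] at hsum
    rw [hs, Finset.mem_insert, Finset.mem_singleton] at hτ
    rcases hτ with rfl | rfl
    · rfl
    · rw [if_neg, if_neg, if_neg, zero_add, zero_add] at hsum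
      · exact CharTwo.add_eq_zero.1 hsum
      all_goals
        intro h
        rw [h] at he
        refine he ?_
      · exact ⟨s(y, u), by simp [triangleWalk], by simp⟩
      · exact ⟨s(x, y), by simp [triangleWalk], by simp⟩
      · exact ⟨s(u, x), by simp [triangleWalk], by simp⟩
  have hreach : ∀ σ τ : S.Tri,
      (S.cutGraph (Sym2.map D '' {e | e ∈ (triangleWalk h1 h2 h3).edges})).Reachable σ τ →
      F σ = F τ := by
    intro σ τ h
    refine eq_of_reachable ?_ h
    rintro σ τ ⟨-, p, q, hpq, a1, a2, a3⟩
    exact hcross p q hpq a3 σ τ a1.1 a1.2 a2.1 a2.2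
  -- No edge of the walk ends at a vertex outside it, so `F` is constant on the star of that vertex.
  have hstar : ∀ v, v ≠ u → v ≠ x → v ≠ y → ∀ σ τ : S.Tri, D v ∈ σ.1 → D v ∈ τ.1 →
      F σ = F τ := by
    intro v hvu hvx hvy σ τ a1 a2
    refine (mem_of_star_closed {ρ | F ρ = F σ} ?_ a1 a2 rfl).symm
    intro q hq π ρ b1 b2 b3 b4 b5
    refine (hcross (D v) q hq ?_ π ρ b1 b2 b3 b4).symm.trans b5
    rintro ⟨e, he, h⟩
    have hv : D v ∈ Sym2.map D e := by rw [h]; simp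
    obtain ⟨v', hv', h'⟩ := Sym2.mem_map.1 hv
    rw [D.injective h'] at hv'
    simp only [triangleWalk, Walk.edges_cons, Walk.edges_nil, List.mem_cons, List.not_mem_nil,
      or_false, Set.mem_ofPred_eq] at he
    rcases he with rfl | rfl | rfl <;> rcases Sym2.mem_iff.1 hv' with h | h <;> contradiction
  refine ⟨F, fun σ τ h => eq_of_faceOf_eq ?_ h, ?_, ?_⟩
  · rintro σ τ ⟨-, p, q, hpq, a1, a2, a3⟩
    refine hcross p q hpq (fun h => a3 ?_) σ τ a1.1 a1.2 a2.1 a2.2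
    obtain ⟨e, he, h⟩ := h
    exact ⟨e, Walk.edges_subset_edgeSet _ he, h⟩
  · intro v w a1 a2 a3 b1 b2 b3 σ τ hσ hτ
    by_contra hne
    refine hs ⟨v, w, ?_, ?_, fun σ' τ' hσ' hτ' h => hne ?_⟩
    · simp [triangleWalk, a1, a2, a3]
    · simp [triangleWalk, b1, b2, b3]
    · rw [hstar v a1 a2 a3 σ σ' hσ hσ', hstar w b1 b2 b3 τ τ' hτ hτ', hreach _ _ h]
  · intro σ τ hne a1 a2 a3 a4 h
    obtain ⟨σ', hne', hs⟩ := exists_other_side hyu a1 a2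
    have hτ : τ ∈ (Finset.univ.filter fun ρ : S.Tri => D y ∈ ρ.1 ∧ D u ∈ ρ.1) := by simp [a3, a4]
    have hsum := hF _ _ hyu
    rw [sum_sides F hne' hs] at hsum
    rw [hs, Finset.mem_insert, Finset.mem_singleton] at hτ
    rcases hτ with rfl | rfl
    · exact hne rfl
    · rw [h, CharTwo.add_self_eq_zero, if_neg, if_neg, if_pos] at hsum
      · simp at hsum
      · rfl
      · simp [hux, hxy.symm]
      · simp [hxy.symm, hyu]

end
end Drawing

/-! ### Induced diamonds in triangulated neighborhoods. -/

namespace Drawing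

open ClosedSurface SimpleGraph

section

open Classical

variable {X V : Type*} [Fintype X] [DecidableEq X] {G : SimpleGraph V} {S : ClosedSurface X}
  {D : Drawing G S} [Fintype V]

omit [Fintype V] in
/-- Every edge has a side on some face; if it is a single side, then there is a second face. -/
theorem exists_two_faces {u v : V} (h : G.Adj u v) :
    ∃ f g : D.Face, 0 < f.sideCount s(u, v) ∧ 0 < g.sideCount s(u, v) ∧
      (f.sideCount s(u, v) = 1 → f ≠ g) := by
  obtain ⟨σ, τ, hne, hs⟩ := exists_sides (adj_skeleton (D := D) h)
  refine ⟨D.faceOf σ, D.faceOf τ, ?_, ?_, ?_⟩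
  · rw [sideCount_eq _ hne hs]; simp
  · rw [sideCount_eq _ hne hs]; simp
  · intro h1 h2
    rw [sideCount_eq _ hne hs] at h1
    simp [h2] at h1

/-- In a triangulated neighborhood of `u`, the edge `uv` is the diagonal of an induced diamond,
unless there is a separating triangle. -/
theorem exists_diamond [Nonempty V] (hdeg : ∀ v, 2 ≤ G.degree v)
    (hc : ∀ (v : V) (C : G.Walk v v), C.IsCycle → C.length ≤ 4 → D.IsContractible C)
    (hs : ∀ (v : V) (C : G.Walk v v), C.IsCycle → C.length = 3 → ¬ D.IsSeparating C)
    {u v : V} (hu : ∀ f : D.Face, f.IncidentVertex u → f.length = 3) (h4 : 4 ≤ G.degree u)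
    (huv : G.Adj u v) :
    ∃ x y, x ≠ y ∧ G.Adj u x ∧ G.Adj u y ∧ G.Adj v x ∧ G.Adj v y ∧ ¬ G.Adj x y := by
  have htri : ∀ (f : D.Face) (a : V), G.Adj u a → 0 < f.sideCount s(u, a) →
      f.OddAdj u a ∧ ∃ b, f.OddAdj u b ∧ f.OddAdj a b ∧
        ∀ w, G.Adj u w → 0 < f.sideCount s(u, w) → w = a ∨ w = b := by
    intro f a ha hpos
    obtain ⟨h1, b, h2, h3, h4⟩ := exists_triangle_of_length_eq hdeg
      (hu f (incidentVertex_of_sideCount_pos hpos (by simp))) ha hpos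
    refine ⟨h1, b, h2, h3, fun w hw hpos => ?_⟩
    have hua := ha.ne
    have hub := h2.1.ne
    rcases h4 _ hw hpos with h | h | h
    · exact .inl (Sym2.congr_right.1 h)
    · exact .inr (Sym2.congr_right.1 h)
    · rw [Sym2.eq_iff] at h
      grind
  have hsmall : ∀ A : Finset V, A.card < 4 → ∃ w, G.Adj u w ∧ w ∉ A := by
    intro A hA
    by_contra! hcon
    have : G.neighborFinset u ⊆ A := fun w hw => hcon w (by simpa using hw)
    have := Finset.card_le_card this
    rw [card_neighborFinset_eq_degree] at this
    omega
  obtain ⟨f, g, hf, hg, hfg⟩ := exists_two_faces (D := D) huv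
  obtain ⟨f1, x, f2, f3, f4⟩ := htri f v huv hf
  obtain ⟨g1, y, g2, g3, g4⟩ := htri g v huv hg
  replace hfg := hfg f1.2
  have pos : ∀ {f : D.Face} {a b : V}, f.OddAdj a b → 0 < f.sideCount s(a, b) := fun h => by
    rw [h.2]; exact one_pos
  by_cases hxy : x = y
  -- If the apexes coincide, `f` and `g` alone close up around `u`, which would then have degree
  -- two.
  · subst hxy
    exfalso
    obtain ⟨w, hw, hw'⟩ := hsmall {v, x} (lt_of_le_of_lt Finset.card_le_two (by norm_num))
    obtain ⟨k, hk, hk'⟩ := exists_sideCount_pos_of_closed ({f, g} : Set D.Face) (f := f) (by simp)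
      hf (fun k hk z hz hpos => by
        have hz' : z = v ∨ z = x := by
          rcases hk with rfl | rfl
          exacts [f4 z hz hpos, g4 z hz hpos]
        rcases hk with rfl | rfl
        · exact ⟨g, by simp, hfg.symm, by rcases hz' with rfl | rfl; exacts [hg, pos g2]⟩
        · exact ⟨f, by simp, hfg, by rcases hz' with rfl | rfl; exacts [hf, pos f2]⟩) hw
    rcases hk with rfl | rfl
    · exact hw' (by simpa using f4 w hw hk')
    · exact hw' (by simpa using g4 w hw hk')
  refine ⟨x, y, hxy, f2.1, g2.1, f3.1, g3.1, fun hadj => ?_⟩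
  -- With `x` and `y` adjacent, `uxy` is a triangle, and its side function `F` takes one value at
  -- all vertices outside it, in particular at `v`. The value across `uy` from `g` is the other one.
  have hcyc := isCycle_triangleWalk f2.1 hadj g2.1.symm
  obtain ⟨F, hF1, hF2, hF3⟩ := exists_side_function f2.1 hadj g2.1.symm
    (hc _ _ hcyc (by simp [triangleWalk])) (hs _ _ hcyc (by simp [triangleWalk]))
  obtain ⟨ρ, hρ, hρ'⟩ := sideCount_pos.1 (pos g2)
  have hyu : D y ≠ D u := D.injective.ne g2.1.ne.symm
  obtain ⟨π, hne, hsides⟩ := exists_other_side hyu (hρ' y (by simp)) (hρ' u (by simp))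
  have hπ : π ∈ (Finset.univ.filter fun ρ : S.Tri => D y ∈ ρ.1 ∧ D u ∈ ρ.1) := by
    rw [hsides]; simp
  simp only [Finset.mem_filter, Finset.mem_univ, true_and] at hπ
  have hFne := hF3 ρ π hne (hρ' y (by simp)) (hρ' u (by simp)) hπ.1 hπ.2
  obtain ⟨σ, hσ, hσ'⟩ := sideCount_pos.1 hf
  obtain ⟨τ, hτ, hτ'⟩ := sideCount_pos.1 hg
  have hvx := f3.1.ne
  have hvy := g3.1.ne
  have hvu := huv.ne.symm
  have hFg : F τ = F ρ := hF1 _ _ (hτ.trans hρ.symm)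
  have hFf : F σ = F τ := hF2 v v hvu hvx hvy hvu hvx hvy σ τ (hσ' v (by simp)) (hτ' v (by simp))
  -- The face beyond `uy` is a triangle `uya`, distinct from `f` and `g` because `F` differs there.
  obtain ⟨k1, a, k2, k3, k4⟩ := htri (D.faceOf π) y g2.1 (sideCount_mk_pos rfl hπ.2 hπ.1)
  have hkg : D.faceOf π ≠ g := fun h => hFne (hF1 _ _ (hρ.trans h.symm))
  have hkf : D.faceOf π ≠ f := fun h => hFne (by
    rw [← hFg, ← hFf]; exact hF1 _ _ (hσ.trans h.symm))
  by_cases hax : a = x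
  -- Now `f`, `g` and the third face close up around `u`, so `u` would have degree three.
  · subst hax
    obtain ⟨w, hw, hw'⟩ := hsmall {v, a, y} (lt_of_le_of_lt Finset.card_le_three (by norm_num))
    simp only [Finset.mem_insert, Finset.mem_singleton, not_or] at hw'
    obtain ⟨k, hk, hk'⟩ := exists_sideCount_pos_of_closed
      ({f, g, D.faceOf π} : Set D.Face) (f := f) (by simp)
      hf (fun k hk z hz hpos => by
        rcases hk with rfl | rfl | rfl
        · rcases f4 z hz hpos with rfl | rfl
          · exact ⟨g, by simp, hfg.symm, hg⟩
          · exact ⟨D.faceOf π, by simp, hkf, pos k2⟩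
        · rcases g4 z hz hpos with rfl | rfl
          · exact ⟨f, by simp, hfg, hf⟩
          · exact ⟨D.faceOf π, by simp, hkg, pos k1⟩
        · rcases k4 z hz hpos with rfl | rfl
          · exact ⟨g, by simp, hkg.symm, pos g2⟩
          · exact ⟨f, by simp, hkf.symm, pos f2⟩) hw
    rcases hk with rfl | rfl | rfl
    · have := f4 w hw hk'; tauto
    · have := g4 w hw hk'; tauto
    · have := k4 w hw hk'; tauto
  -- Here `a` is outside the triangle `uxy`, so `F` agrees at `a` and at `v`, although they see
  -- opposite sides.
  · obtain ⟨κ, hκ, hκ'⟩ := sideCount_pos.1 (pos k2)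
    have h1 := hF2 v a hvu hvx hvy k2.1.ne.symm hax k3.1.ne.symm τ κ (hτ' v (by simp))
      (hκ' a (by simp))
    exact hFne (by rw [← hFg, h1]; exact hF1 _ _ hκ)

end
end Drawing

/-! ### Three sparsifiers -/

section Sparsifiers

variable {W : Type*}

/-- When non-adjacent vertices have the same neighbors, opacity only concerns pairs of vertices
that are adjacent or have a common neighbor. -/
theorem isOpaque_of_pairs {S : SimpleGraph W}
    (hS : ∀ u v w, u ≠ v → ¬ S.Adj u v → S.Adj u w → S.Adj v w) {B : W → Multiset ℕ} {φ : W → ℕ}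
    (h1 : ∀ v, (B v).count (φ v) ≤ 1)
    (h2 : ∀ u v, S.Adj u v → φ u ∈ B u → φ v ∈ B v → φ u ≠ φ v)
    (h3 : ∀ u v w, u ≠ v → S.Adj u w → S.Adj v w → φ u ∈ B u → φ v ∈ B v → φ u = φ v →
      φ w ≠ φ u) : IsOpaque S B φ := by
  intro a H hH hcol
  refine ⟨fun u hu v hv hau hav => ?_, fun v hv hav => ?_⟩
  · by_contra hne
    have hφu := hcol u hu
    have hφv := hcol v hv
    have hnadj : ¬ S.Adj u v := fun h =>
      h2 u v h (hφu ▸ hau) (hφv ▸ hav) (hφu.trans hφv.symm)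
    obtain ⟨p⟩ := hH.preconnected ⟨u, hu⟩ ⟨v, hv⟩
    cases p with
    | nil => exact hne rfl
    -- The first vertex after `u` on a path to `v` is a common neighbor, because non-adjacent
    -- vertices have the same neighbors.
    | @cons _ w _ hadj _ =>
      have huw : S.Adj u w.1 := H.adj_sub hadj
      exact h3 u v w.1 hne huw (hS u v w.1 hne hnadj huw) (hφu ▸ hau) (hφv ▸ hav)
        (hφu.trans hφv.symm) ((hcol w.1 w.2).trans hφu.symm)
  · refine le_antisymm ?_ (Multiset.one_le_count_iff_mem.2 hav)
    exact (hcol v hv) ▸ h1 v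

/-- Give every color of `L` two slots, and let each occurrence in `B` use one. The surviving slots
are the choices counted below: an unused color keeps two, a color occurring once keeps one. -/
theorem le_sum_two_sub_count {L : Finset ℕ} {B : Multiset ℕ} {m : ℕ}
    (h : Multiset.card B + m ≤ 2 * L.card) : m ≤ ∑ a ∈ L, (2 - B.count a) := by
  have h1 : ∑ a ∈ L, B.count a ≤ Multiset.card B := by
    rw [← Multiset.toFinset_sum_count_eq]
    exact Finset.sum_le_sum_of_ne_zero fun a _ ha => by simpa using ha
  have h2 : ∑ a ∈ L, 2 ≤ ∑ a ∈ L, (2 - B.count a) + ∑ a ∈ L, B.count a := by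
    rw [← Finset.sum_add_distrib]
    exact Finset.sum_le_sum fun a _ => by omega
  simp only [Finset.sum_const, smul_eq_mul] at h2
  omega

/-- A set of colors for a vertex with two choices, where a color of `Z` counts twice; `Z` stands
for the colors that do not occur at the vertex, `A` for those that occur at most once. -/
def TwoChoices (A Z : ℕ → Prop) (K : Finset ℕ) : Prop :=
  (∃ a, K = {a} ∧ Z a) ∨ ∃ a b, a ≠ b ∧ K = {a, b} ∧ A a ∧ A b

/-- The analogue of `TwoChoices` for a vertex with three choices, where a color of `Z` counts
twice. -/
def ThreeChoices (A Z : ℕ → Prop) (K : Finset ℕ) : Prop :=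
  (∃ a b, a ≠ b ∧ K = {a, b} ∧ Z a ∧ A b) ∨
    ∃ a b c, a ≠ b ∧ a ≠ c ∧ b ≠ c ∧ K = {a, b, c} ∧ A a ∧ A b ∧ A c

theorem TwoChoices.exists_mem {A Z : ℕ → Prop} {K : Finset ℕ} (hZA : ∀ a, Z a → A a)
    (h : TwoChoices A Z K) (c : ℕ) : ∃ b ∈ K, A b ∧ (b = c → Z b) := by
  rcases h with ⟨a, rfl, ha⟩ | ⟨a, b, hab, rfl, ha, hb⟩
  · exact ⟨a, by simp, hZA a ha, fun _ => ha⟩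
  · by_cases h : a = c
    · exact ⟨b, by simp, hb, fun h' => absurd (h.trans h'.symm) hab⟩
    · exact ⟨a, by simp, ha, fun h' => absurd h' h⟩

theorem TwoChoices.avail {A Z : ℕ → Prop} {K : Finset ℕ} (hZA : ∀ a, Z a → A a)
    (h : TwoChoices A Z K) {a : ℕ} (ha : a ∈ K) : A a := by
  rcases h with ⟨b, rfl, hb⟩ | ⟨b, c, -, rfl, hb, hc⟩
  · grind
  · grind

theorem ThreeChoices.avail {A Z : ℕ → Prop} {K : Finset ℕ} (hZA : ∀ a, Z a → A a)
    (h : ThreeChoices A Z K) {a : ℕ} (ha : a ∈ K) : A a := by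
  rcases h with ⟨b, c, -, rfl, hb, hc⟩ | ⟨b, c, d, -, -, -, rfl, hb, hc, hd⟩
  · grind
  · grind

theorem ThreeChoices.exists_mem {A Z : ℕ → Prop} {K : Finset ℕ} (hZA : ∀ a, Z a → A a)
    (h : ThreeChoices A Z K) (c d : ℕ) :
    ∃ b ∈ K, A b ∧ (b = c → Z b) ∧ (b = d → Z b) ∧ ¬ (b = c ∧ b = d) := by
  rcases h with ⟨x, y, hxy, rfl, hx, hy⟩ | ⟨x, y, z, hxy, hxz, hyz, rfl, hx, hy, hz⟩
  · by_cases h : x = c ∧ x = d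
    · exact ⟨y, by simp, hy, by grind⟩
    · exact ⟨x, by simp, hZA x hx, by grind⟩
  · by_cases h1 : x = c ∨ x = d
    · by_cases h2 : y = c ∨ y = d
      · exact ⟨z, by simp, hz, by grind⟩
      · exact ⟨y, by simp, hy, by grind⟩
    · exact ⟨x, by simp, hx, by grind⟩

/-- The coloring condition for a quadrangle. -/
def QuadrangleColoring (A Z : Fin 4 → ℕ → Prop) (φ : Fin 4 → ℕ) : Prop :=
  ∀ i, A i (φ i) ∧ (φ i = φ (i + 1) → Z i (φ i) ∨ Z (i + 1) (φ (i + 1))) ∧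
    (φ i = φ (i + 2) → φ i = φ (i + 1) → Z i (φ i) ∨ Z (i + 2) (φ (i + 2)))

/-- Start with `a` at vertex 0 and go around greedily: each next vertex avoids the color of its
predecessor or takes a color of `Z`. The last edge closes properly since `a` is not in `K 3`. -/
theorem exists_quadrangleColoring_of_mem {A Z : Fin 4 → ℕ → Prop} (hZA : ∀ i a, Z i a → A i a)
    {K : Fin 4 → Finset ℕ} (hK : ∀ i, TwoChoices (A i) (Z i) (K i)) {a : ℕ} (ha : a ∈ K 0)
    (ha' : a ∉ K 3) : ∃ φ, QuadrangleColoring A Z φ := by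
  obtain ⟨b, hb, hb1, hb2⟩ := (hK 1).exists_mem (hZA 1) a
  obtain ⟨c, hc, hc1, hc2⟩ := (hK 2).exists_mem (hZA 2) b
  obtain ⟨d, hd, hd1, hd2⟩ := (hK 3).exists_mem (hZA 3) c
  have h0 := (hK 0).avail (hZA 0) ha
  have hda : d ≠ a := fun h => ha' (h ▸ hd)
  refine ⟨![a, b, c, d], fun i => ?_⟩
  fin_cases i
  · exact ⟨h0, fun h => .inr (hb2 h.symm), fun h h' => .inr (hc2 (h.symm.trans h'))⟩
  · exact ⟨hb1, fun h => .inr (hc2 h.symm), fun h h' => .inr (hd2 (h.symm.trans h'))⟩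
  · exact ⟨hc1, fun h => .inr (hd2 h.symm), fun h h' => absurd (h'.symm.trans h) hda⟩
  · exact ⟨hd1, fun h => absurd h hda, fun _ h' => absurd h' hda⟩

theorem exists_quadrangleColoring {A Z : Fin 4 → ℕ → Prop} (hZA : ∀ i a, Z i a → A i a)
    {K : Fin 4 → Finset ℕ} (hK : ∀ i, TwoChoices (A i) (Z i) (K i)) :
    ∃ φ, QuadrangleColoring A Z φ := by
  by_cases h : ∀ r, K r ⊆ K (r + 3)
  -- Inclusions all around the cycle force equal sets; then a constant coloring or an alternating
  -- one works.
  · have h1 : ∀ r, K r = K 0 := by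
      have e0 : K 0 ⊆ K 3 := h 0
      have e3 : K 3 ⊆ K 2 := h 3
      have e2 : K 2 ⊆ K 1 := h 2
      have e1 : K 1 ⊆ K 0 := h 1
      intro r
      fin_cases r
      · rfl
      · exact e1.antisymm ((e0.trans e3).trans e2)
      · exact (e2.trans e1).antisymm (e0.trans e3)
      · exact ((e3.trans e2).trans e1).antisymm e0
    have hK' := fun r => h1 r ▸ hK r
    have avail : ∀ r, ∀ a ∈ K 0, A r a := fun r a => (hK' r).avail (hZA r)
    rcases hK 0 with ⟨a, h0, ha⟩ | ⟨a, b, hab, h0, ha, hb⟩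
    · rw [h0] at hK'
      have hZ : ∀ r, Z r a := fun r => by
        rcases hK' r with ⟨c, h1, h2⟩ | ⟨c, d, hcd, h1, -⟩
        · rwa [Finset.singleton_inj.1 h1]
        · have := congrArg Finset.card h1
          rw [Finset.card_pair hcd] at this
          simp at this
      exact ⟨fun _ => a, fun i => ⟨hZA i a (hZ i), fun _ => .inl (hZ i), fun _ _ => .inl (hZ i)⟩⟩
    · rw [h0] at avail
      refine ⟨![a, b, a, b], fun i => ?_⟩
      fin_cases i
      · exact ⟨avail 0 a (by simp), fun h => absurd h hab, fun _ h => absurd h hab⟩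
      · exact ⟨avail 1 b (by simp), fun h => absurd h hab.symm, fun _ h => absurd h hab.symm⟩
      · exact ⟨avail 2 a (by simp), fun h => absurd h hab, fun _ h => absurd h hab⟩
      · exact ⟨avail 3 b (by simp), fun h => absurd h hab.symm, fun _ h => absurd h hab.symm⟩
  · push Not at h
    obtain ⟨r, hr⟩ := h
    obtain ⟨a, ha, ha'⟩ := Finset.not_subset.1 hr
    -- Rotate so that `r` becomes vertex 0; its predecessor is `r + 3`.
    obtain ⟨φ, hφ⟩ := exists_quadrangleColoring_of_mem (A := fun i => A (r + i))
      (Z := fun i => Z (r + i)) (fun i => hZA (r + i)) (fun i => hK (r + i)) (a := a)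
      (by simpa using ha) ha'
    refine ⟨fun i => φ (i - r), fun i => ?_⟩
    have := hφ (i - r)
    have e0 : r + (i - r) = i := by abel
    have e1 : r + (i + 1 - r) = i + 1 := by abel
    have e2 : r + (i + 2 - r) = i + 2 := by abel
    have e1' : i - r + 1 = i + 1 - r := by abel
    have e2' : i - r + 2 = i + 2 - r := by abel
    simpa only [e0, e1, e2, e1', e2'] using this

/-- The coloring condition for a diamond, whose vertices `x` and `y` are not adjacent. -/
def DiamondColoring (Au Zu Av Zv Ax Zx Ay Zy : ℕ → Prop) (u v x y : ℕ) : Prop :=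
  (Au u ∧ Av v ∧ Ax x ∧ Ay y) ∧ (u = v → Zu u ∨ Zv v) ∧ (u = x → Zu u ∨ Zx x) ∧
    (u = y → Zu u ∨ Zy y) ∧ (v = x → Zv v ∨ Zx x) ∧ (v = y → Zv v ∨ Zy y) ∧
    (x = y → u = x ∨ v = x → Zx x ∨ Zy y)

section Diamond

variable {Au Zu Av Zv Ax Zx Ay Zy : ℕ → Prop} {Mu Mv Kx Ky : Finset ℕ}

theorem DiamondColoring.swap_uv {u v x y : ℕ}
    (h : DiamondColoring Au Zu Av Zv Ax Zx Ay Zy u v x y) :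
    DiamondColoring Av Zv Au Zu Ax Zx Ay Zy v u x y := by
  unfold DiamondColoring at *
  grind

theorem DiamondColoring.swap_xy {u v x y : ℕ}
    (h : DiamondColoring Au Zu Av Zv Ax Zx Ay Zy u v x y) :
    DiamondColoring Au Zu Av Zv Ay Zy Ax Zx u v y x := by
  unfold DiamondColoring at *
  grind

/-- Greedy coloring in the order `x`, `y`, `v`, `u`: when `u` is reached, `x` cannot conflict with
it, and three choices suffice against `y` and `v`. -/
theorem exists_diamondColoring_of_not_mem (hu : ∀ a, Zu a → Au a) (hv : ∀ a, Zv a → Av a)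
    (hx : ∀ a, Zx a → Ax a) (hy : ∀ a, Zy a → Ay a)
    (hMu : ThreeChoices Au Zu Mu) (hMv : ThreeChoices Av Zv Mv) (hKx : TwoChoices Ax Zx Kx)
    (hKy : TwoChoices Ay Zy Ky) {a : ℕ} (ha : a ∈ Kx) (ha' : a ∉ Mu) :
    ∃ u v x y, DiamondColoring Au Zu Av Zv Ax Zx Ay Zy u v x y := by
  obtain ⟨b, hb, hb1, -⟩ := hKy.exists_mem hy a
  obtain ⟨c, hc, hc1, hc2, hc3, hc4⟩ := hMv.exists_mem hv a b
  obtain ⟨d, hd, hd1, hd2, hd3, hd4⟩ := hMu.exists_mem hu b c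
  have ha1 := hKx.avail hx ha
  have hda : d ≠ a := fun h => ha' (h ▸ hd)
  refine ⟨d, c, a, b, ?_⟩
  unfold DiamondColoring
  grind

/-- Color both `x` and `y` by a common color that is not doubly available at `u`. -/
theorem exists_diamondColoring_of_common (hv : ∀ a, Zv a → Av a)
    (hx : ∀ a, Zx a → Ax a) (hy : ∀ a, Zy a → Ay a) (hMv : ThreeChoices Av Zv Mv)
    (hKx : TwoChoices Ax Zx Kx) (hKy : TwoChoices Ay Zy Ky) {a : ℕ} (hax : a ∈ Kx) (hay : a ∈ Ky)
    (hau : ∀ c, ∃ d, Au d ∧ d ≠ a ∧ (d = c → Zu d)) :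
    ∃ u v x y, DiamondColoring Au Zu Av Zv Ax Zx Ay Zy u v x y := by
  obtain ⟨c, hc, hc1, -, -, hc4⟩ := hMv.exists_mem hv a a
  obtain ⟨d, hd1, hd2, hd3⟩ := hau c
  have h1 := hKx.avail hx hax
  have h2 := hKy.avail hy hay
  refine ⟨d, c, a, a, ?_⟩
  unfold DiamondColoring
  grind

/-- Color `u` and `x` with `a`, which is harmless as it is unused at `x`. Then `v` and `y` use `Ky`:
either a shared color unused at `y`, or two different colors. -/
theorem exists_diamondColoring_of_single (hu : ∀ a ∈ Mu, Au a) (hv : ∀ a ∈ Mv, Av a)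
    (hx : ∀ a, Zx a → Ax a) (hy : ∀ a, Zy a → Ay a)
    (hKy : TwoChoices Ay Zy Ky) {a : ℕ} (hxa : Zx a) (hau : a ∈ Mu) (hay : a ∉ Ky)
    (hyv : Ky ⊆ Mv) : ∃ u v x y, DiamondColoring Au Zu Av Zv Ax Zx Ay Zy u v x y := by
  rcases hKy with ⟨b, rfl, hb⟩ | ⟨b, c, hbc, rfl, hb, hc⟩
  · refine ⟨a, b, a, b, ?_⟩
    have := hv b (hyv (by simp))
    have := hu a hau
    unfold DiamondColoring
    grind
  · refine ⟨a, b, a, c, ?_⟩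
    have := hv b (hyv (by simp))
    have := hu a hau
    unfold DiamondColoring
    grind

theorem exists_diamondColoring (hu : ∀ a, Zu a → Au a) (hv : ∀ a, Zv a → Av a)
    (hx : ∀ a, Zx a → Ax a) (hy : ∀ a, Zy a → Ay a)
    (hMu : ThreeChoices Au Zu Mu) (hMv : ThreeChoices Av Zv Mv) (hKx : TwoChoices Ax Zx Kx)
    (hKy : TwoChoices Ay Zy Ky) :
    ∃ u v x y, DiamondColoring Au Zu Av Zv Ax Zx Ay Zy u v x y := by
  by_cases hxu : Kx ⊆ Mu
  swap
  · obtain ⟨a, ha, ha'⟩ := Finset.not_subset.1 hxu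
    exact exists_diamondColoring_of_not_mem hu hv hx hy hMu hMv hKx hKy ha ha'
  by_cases hxv : Kx ⊆ Mv
  swap
  · obtain ⟨a, ha, ha'⟩ := Finset.not_subset.1 hxv
    obtain ⟨v, u, x, y, h⟩ :=
      exists_diamondColoring_of_not_mem hv hu hx hy hMv hMu hKx hKy ha ha'
    exact ⟨u, v, x, y, h.swap_uv⟩
  by_cases hyu : Ky ⊆ Mu
  swap
  · obtain ⟨a, ha, ha'⟩ := Finset.not_subset.1 hyu
    obtain ⟨u, v, y, x, h⟩ :=
      exists_diamondColoring_of_not_mem hu hv hy hx hMu hMv hKy hKx ha ha'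
    exact ⟨u, v, x, y, h.swap_xy⟩
  by_cases hyv : Ky ⊆ Mv
  swap
  · obtain ⟨a, ha, ha'⟩ := Finset.not_subset.1 hyv
    obtain ⟨v, u, y, x, h⟩ :=
      exists_diamondColoring_of_not_mem hv hu hy hx hMv hMu hKy hKx ha ha'
    exact ⟨u, v, x, y, h.swap_xy.swap_uv⟩
  have havu := fun a => hMu.avail hu (a := a)
  have havv := fun a => hMv.avail hv (a := a)
  by_cases hcom : ∃ a, a ∈ Kx ∧ a ∈ Ky
  · obtain ⟨a, hax, hay⟩ := hcom
    have goU := exists_diamondColoring_of_common (Au := Au) (Zu := Zu) (a := a) hv hx hy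
      hMv hKx hKy hax hay
    have goV := exists_diamondColoring_of_common (Au := Av) (Zu := Zv) (a := a) hu hx hy
      hMu hKx hKy hax hay
    by_cases hau : ∀ c, ∃ d, Au d ∧ d ≠ a ∧ (d = c → Zu d)
    · exact goU hau
    by_cases hav : ∀ c, ∃ d, Av d ∧ d ≠ a ∧ (d = c → Zv d)
    · obtain ⟨v, u, x, y, h⟩ := goV hav
      exact ⟨u, v, x, y, h.swap_uv⟩
    -- Removing `a` leaves `u` with fewer than two choices, so `a` counts double there; likewise at
    -- `v`.
    have hMu' : ∃ b, a ≠ b ∧ Mu = {a, b} ∧ Zu a := by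
      rcases hMu with ⟨z, b, hzb, rfl, hz, hb⟩ | ⟨b, c, d, h1, h2, h3, rfl, hb, hc, hd⟩
      · by_cases hza : z = a
        · exact ⟨b, hza ▸ hzb, by rw [hza], hza ▸ hz⟩
        · exact absurd (fun c => ⟨z, hu z hz, hza, fun _ => hz⟩) hau
      · refine absurd (fun e => ?_) hau
        by_cases e1 : b ≠ a ∧ b ≠ e
        · exact ⟨b, hb, e1.1, fun h => absurd h e1.2⟩
        by_cases e2 : c ≠ a ∧ c ≠ e
        · exact ⟨c, hc, e2.1, fun h => absurd h e2.2⟩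
        · exact ⟨d, hd, by grind, by grind⟩
    have hMv' : Zv a := by
      rcases hMv with ⟨z, b, hzb, rfl, hz, hb⟩ | ⟨b, c, d, h1, h2, h3, rfl, hb, hc, hd⟩
      · by_cases hza : z = a
        · exact hza ▸ hz
        · exact absurd (fun c => ⟨z, hv z hz, hza, fun _ => hz⟩) hav
      · refine absurd (fun e => ?_) hav
        by_cases e1 : b ≠ a ∧ b ≠ e
        · exact ⟨b, hb, e1.1, fun h => absurd h e1.2⟩
        by_cases e2 : c ≠ a ∧ c ≠ e
        · exact ⟨c, hc, e2.1, fun h => absurd h e2.2⟩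
        · exact ⟨d, hd, by grind, by grind⟩
    obtain ⟨b, hab, rfl, hZu⟩ := hMu'
    by_cases hZ : Zx a ∨ Zy a
    · have h1 := hKx.avail hx hax
      have h2 := hKy.avail hy hay
      -- Color everything `a`: only one of `x` and `y` can have it in its multiset.
      refine ⟨a, a, a, a, ?_⟩
      unfold DiamondColoring
      grind
    -- Otherwise `Kx` and `Ky` are both $\{a, b\}$. Color `x` and `y` with `b`, leaving the doubly
    -- available `a` for `u`.
    · have hbx : b ∈ Kx := by
        rcases hKx with ⟨c, rfl, hc⟩ | ⟨c, d, hcd, rfl, hc, hd⟩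
        · exact absurd (.inl (by simp at hax; exact hax ▸ hc)) hZ
        · have h1 := hxu (show c ∈ ({c, d} : Finset ℕ) by simp)
          have h2 := hxu (show d ∈ ({c, d} : Finset ℕ) by simp)
          grind
      have hby : b ∈ Ky := by
        rcases hKy with ⟨c, rfl, hc⟩ | ⟨c, d, hcd, rfl, hc, hd⟩
        · exact absurd (.inr (by simp at hay; exact hay ▸ hc)) hZ
        · have h1 := hyu (show c ∈ ({c, d} : Finset ℕ) by simp)
          have h2 := hyu (show d ∈ ({c, d} : Finset ℕ) by simp)
          grind
      exact exists_diamondColoring_of_common hv hx hy hMv hKx hKy hbx hby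
        fun _ => ⟨a, hu a hZu, hab, fun _ => hZu⟩
  · have hdisj : Disjoint Kx Ky := Finset.disjoint_left.2 fun a h1 h2 => hcom ⟨a, h1, h2⟩
    rcases id hKx with ⟨a, hKa, hZa⟩ | ⟨a, b, hab, hKab, ha, hb⟩
    · exact exists_diamondColoring_of_single havu havv hx hy hKy hZa
        (hxu (by simp [hKa])) (fun h => hcom ⟨a, by simp [hKa], h⟩) hyv
    rcases id hKy with ⟨c, hKc, hZc⟩ | ⟨c, d, hcd, hKcd, hc, hd⟩
    · obtain ⟨u, v, y, x, h⟩ := exists_diamondColoring_of_single havu havv hy hx hKx hZc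
        (hyu (by simp [hKc])) (fun h => hcom ⟨c, h, by simp [hKc]⟩) hxv
      exact ⟨u, v, x, y, h.swap_xy⟩
    -- Two disjoint pairs do not fit into `Mu`, which has at most three colors.
    · have h1 := Finset.card_le_card (Finset.union_subset hxu hyu)
      rw [Finset.card_union_of_disjoint hdisj, hKab, hKcd, Finset.card_pair hab,
        Finset.card_pair hcd] at h1
      have h2 : Mu.card ≤ 3 := by
        rcases hMu with ⟨a, b, -, rfl, -⟩ | ⟨a, b, c, -, -, -, rfl, -⟩
        · exact Finset.card_le_two.trans (by norm_num)
        · exact Finset.card_le_three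
      omega

end Diamond

end Sparsifiers

/-! ### From lists and multisets to choices, and the sparsifier property. -/

section Sparsifiers

open SimpleGraph

/-- The colors of `L` that occur at most once in `B`. -/
def Avail (L : Finset ℕ) (B : Multiset ℕ) (a : ℕ) : Prop := a ∈ L ∧ B.count a ≤ 1

/-- The colors of `L` that do not occur in `B`. -/
def Unused (L : Finset ℕ) (B : Multiset ℕ) (a : ℕ) : Prop := a ∈ L ∧ a ∉ B

theorem Unused.avail {L : Finset ℕ} {B : Multiset ℕ} (a : ℕ) (h : Unused L B a) : Avail L B a :=
  ⟨h.1, by rw [Multiset.count_eq_zero_of_notMem h.2]; exact zero_le_one⟩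

theorem exists_avail {L : Finset ℕ} {B : Multiset ℕ} (h : Multiset.card B + 1 ≤ 2 * L.card) :
    ∃ a, Avail L B a := by
  by_contra! hcon
  have h1 := le_sum_two_sub_count h
  rw [Finset.sum_eq_zero] at h1
  · omega
  · intro a ha
    have : ¬ B.count a ≤ 1 := fun h => hcon a ⟨ha, h⟩
    omega

/-- Without unused colors, every color keeps at most one slot, so the slots are counted by the
available colors. -/
theorem le_card_avail {L : Finset ℕ} {B : Multiset ℕ} {m : ℕ}
    (h : Multiset.card B + m ≤ 2 * L.card) (hz : ∀ a, ¬ Unused L B a) :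
    m ≤ (L.filter fun a => B.count a ≤ 1).card := by
  refine (le_sum_two_sub_count h).trans ?_
  rw [Finset.card_filter]
  refine Finset.sum_le_sum fun a ha => ?_
  have : a ∈ B := by
    by_contra hn
    exact hz a ⟨ha, hn⟩
  have := Multiset.one_le_count_iff_mem.2 this
  split_ifs <;> omega

theorem exists_twoChoices {L : Finset ℕ} {B : Multiset ℕ} (h : Multiset.card B + 2 ≤ 2 * L.card) :
    ∃ K, TwoChoices (Avail L B) (Unused L B) K := by
  by_cases hz : ∃ a, Unused L B a
  · obtain ⟨a, ha⟩ := hz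
    exact ⟨{a}, .inl ⟨a, rfl, ha⟩⟩
  · push Not at hz
    obtain ⟨a, ha, b, hb, hab⟩ := Finset.one_lt_card.1 (le_card_avail h hz)
    rw [Finset.mem_filter] at ha hb
    exact ⟨{a, b}, .inr ⟨a, b, hab, rfl, ha, hb⟩⟩

theorem exists_threeChoices {L : Finset ℕ} {B : Multiset ℕ}
    (h : Multiset.card B + 3 ≤ 2 * L.card) :
    ∃ K, ThreeChoices (Avail L B) (Unused L B) K := by
  by_cases hz : ∃ a, Unused L B a
  · obtain ⟨a, ha⟩ := hz
    -- The unused color accounts for two of the three choices; the rest of `L` still offers one.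
    have h1 : Multiset.card B + 1 ≤ 2 * (L.erase a).card := by
      rw [Finset.card_erase_of_mem ha.1]
      omega
    obtain ⟨b, hb, hb'⟩ := exists_avail h1
    exact ⟨{a, b}, .inl ⟨a, b, (Finset.ne_of_mem_erase hb).symm, rfl, ha,
      Finset.mem_of_mem_erase hb, hb'⟩⟩
  · push Not at hz
    obtain ⟨a, ha, b, hb, c, hc, hab, hac, hbc⟩ := Finset.two_lt_card.1 (le_card_avail h hz)
    rw [Finset.mem_filter] at ha hb hc
    exact ⟨{a, b, c}, .inr ⟨a, b, c, hab, hac, hbc, rfl, ha, hb, hc⟩⟩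

/-- A single vertex of degree less than `2c` is a `c`-sparsifier. -/
theorem isSparsifier_single {c k : ℕ} (hk : k < 2 * c) :
    IsSparsifier c (⊥ : SimpleGraph (Fin 1)) fun _ => k := by
  refine ⟨⟨fun a b => by rw [Subsingleton.elim a b]⟩, fun v => by simp, fun L B hL hB => ?_⟩
  have h : ∀ v, ∃ a, Avail (L v) (B v) a := fun v => exists_avail (by
    have := hB v
    simp only [bot_degree, add_zero] at this
    rw [hL v]
    omega)
  choose φ hφ using h
  refine ⟨φ, fun v => (hφ v).1, isOpaque_of_pairs ?_ (fun v => (hφ v).2) ?_ ?_⟩ <;> simp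

/-- The 4-cycle. -/
def quadrangle : SimpleGraph (Fin 4) where
  Adj i j := j = i + 1 ∨ i = j + 1
  symm := ⟨fun _ _ h => h.symm⟩
  loopless := ⟨by decide⟩

instance : DecidableRel quadrangle.Adj :=
  fun i j => inferInstanceAs (Decidable (j = i + 1 ∨ i = j + 1))

/-- The complete graph on four vertices minus an edge. -/
def diamond : SimpleGraph (Fin 4) where
  Adj i j := i ≠ j ∧ ¬ (2 ≤ i ∧ 2 ≤ j)
  symm := ⟨fun _ _ h => ⟨h.1.symm, fun k => h.2 k.symm⟩⟩
  loopless := ⟨fun _ h => h.1 rfl⟩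

instance : DecidableRel diamond.Adj :=
  fun i j => inferInstanceAs (Decidable (i ≠ j ∧ ¬ (2 ≤ i ∧ 2 ≤ j)))

theorem quadrangle_degree : ∀ i, quadrangle.degree i = 2 := by decide

theorem diamond_degree_zero : diamond.degree 0 = 3 := by decide
theorem diamond_degree_one : diamond.degree 1 = 3 := by decide
theorem diamond_degree_two : diamond.degree 2 = 2 := by decide
theorem diamond_degree_three : diamond.degree 3 = 2 := by decide

/-- Each vertex has $2c = 4$ slots and a multiset of at most $4 - 2$ colors, hence two choices. -/
theorem isSparsifier_quadrangle : IsSparsifier 2 quadrangle fun _ => 4 := by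
  refine ⟨⟨fun a b => ?_⟩, fun v => by simp [quadrangle_degree], fun L B hL hB => ?_⟩
  · have h : ∀ a : Fin 4, quadrangle.Reachable a (a + 1) := fun a =>
      Adj.reachable (.inl rfl)
    have h0 : ∀ a : Fin 4, quadrangle.Reachable 0 a := by
      have h1 := h 0
      have h2 := h1.trans (h 1)
      have h3 := h2.trans (h 2)
      intro a
      fin_cases a
      exacts [.rfl, h1, h2, h3]
    exact (h0 a).symm.trans (h0 b)
  have hK : ∀ v, ∃ K, TwoChoices (Avail (L v) (B v)) (Unused (L v) (B v)) K := fun v =>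
    exists_twoChoices (by
      have := hB v
      rw [quadrangle_degree] at this
      rw [hL v]
      omega)
  choose K hK using hK
  obtain ⟨φ, hφ⟩ := exists_quadrangleColoring (fun _ => Unused.avail) hK
  have hedge : ∀ i, φ i ∈ B i → φ (i + 1) ∈ B (i + 1) → φ i ≠ φ (i + 1) := fun i h1 h2 h =>
    ((hφ i).2.1 h).elim (fun h => h.2 h1) fun h => h.2 h2
  refine ⟨φ, fun v => (hφ v).1.1, isOpaque_of_pairs (by decide) (fun v => (hφ v).1.2) ?_ ?_⟩
  · rintro u v (rfl | rfl) hu hv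
    · exact hedge _ hu hv
    · exact (hedge _ hv hu).symm
  · intro u v w hne hu hv hBu hBv huv hw
    have key : v = u + 2 ∧ (w = u + 1 ∨ w = v + 1) := by
      clear hBu hBv huv hw
      revert u v w
      decide
    obtain ⟨rfl, rfl | rfl⟩ := key
    · exact ((hφ u).2.2 huv hw.symm).elim (fun h => h.2 hBu) fun h => h.2 hBv
    -- `QuadrangleColoring` at index `u + 2` covers the common neighbor on the other side.
    · have h2 : u = u + 2 + 2 := by rw [add_assoc]; exact (add_zero u).symm
      have := (hφ (u + 2)).2.2
      rw [← h2] at this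
      exact (this huv.symm (huv.symm.trans hw.symm)).elim (fun h => h.2 hBv) fun h => h.2 hBu

/-- Of the $2c = 6$ slots at a vertex at most $6 - \deg$ are used up, which leaves as many choices
as the degree: three at 0 and 1, two at 2 and 3. -/
theorem isSparsifier_diamond : IsSparsifier 3 diamond fun _ => 6 := by
  refine ⟨⟨fun a b => ?_⟩, by decide, fun L B hL hB => ?_⟩
  · have h0 : ∀ a : Fin 4, diamond.Reachable 0 a := by
      intro a
      by_cases h : a = 0
      · rw [h]
      · exact Adj.reachable ⟨Ne.symm h, by simp⟩
    exact (h0 a).symm.trans (h0 b)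
  have h0 := hB 0
  have h1 := hB 1
  have h2 := hB 2
  have h3 := hB 3
  rw [diamond_degree_zero] at h0
  rw [diamond_degree_one] at h1
  rw [diamond_degree_two] at h2
  rw [diamond_degree_three] at h3
  obtain ⟨Mu, hMu⟩ := exists_threeChoices (L := L 0) (B := B 0) (by rw [hL]; omega)
  obtain ⟨Mv, hMv⟩ := exists_threeChoices (L := L 1) (B := B 1) (by rw [hL]; omega)
  obtain ⟨Kx, hKx⟩ := exists_twoChoices (L := L 2) (B := B 2) (by rw [hL]; omega)
  obtain ⟨Ky, hKy⟩ := exists_twoChoices (L := L 3) (B := B 3) (by rw [hL]; omega)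
  obtain ⟨u, v, x, y, ⟨hu, hv, hx, hy⟩, huv, hux, huy, hvx, hvy, hxy⟩ := exists_diamondColoring
    Unused.avail Unused.avail Unused.avail Unused.avail hMu hMv hKx hKy
  refine ⟨![u, v, x, y], ?_, isOpaque_of_pairs (by decide) ?_ ?_ ?_⟩
  · intro i
    fin_cases i
    exacts [hu.1, hv.1, hx.1, hy.1]
  · intro i
    fin_cases i
    exacts [hu.2, hv.2, hx.2, hy.2]
  · intro i j hij hi hj h
    simp only [Unused] at *
    fin_cases i <;> fin_cases j <;> simp [diamond] at hij hi hj h <;> grind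
  · intro i j k hne hik hjk hi hj h hk
    simp only [Unused] at *
    fin_cases i <;> fin_cases j <;> fin_cases k <;> simp [diamond] at hne hik hjk hi hj h hk <;>
      grind

end Sparsifiers

/-! ### Growth of neighborhoods. -/

namespace SimpleGraph

section

open Classical

variable {V : Type*} [Fintype V] (G : SimpleGraph V)

/-- The closed neighborhood of a set of vertices. -/
noncomputable def closedNbhd (Z : Finset V) : Finset V := Z ∪ Z.biUnion fun v => G.neighborFinset v

variable {G}

theorem mem_closedNbhd_of_adj {Z : Finset V} {u v : V} (h : G.Adj u v) (hv : v ∈ Z) :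
    u ∈ G.closedNbhd Z :=
  Finset.mem_union_right _ (Finset.mem_biUnion.2 ⟨v, hv, by simpa using h.symm⟩)

/-- Degrees above `d` are charged to the total excess, so that no bound on the maximum degree is
needed. -/
theorem card_closedNbhd_le (d : ℕ) (Z : Finset V) :
    (G.closedNbhd Z).card ≤ (d + 1) * Z.card + ∑ v, (G.degree v - d) := by
  have h1 : ∑ v ∈ Z, G.degree v ≤ d * Z.card + ∑ v, (G.degree v - d) := by
    have : ∑ v ∈ Z, G.degree v ≤ ∑ v ∈ Z, (d + (G.degree v - d)) :=
      Finset.sum_le_sum fun v _ => by omega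
    rw [Finset.sum_add_distrib, Finset.sum_const, smul_eq_mul, mul_comm] at this
    exact this.trans (Nat.add_le_add_left
      (Finset.sum_le_sum_of_subset (Finset.subset_univ Z)) _)
  have h2 : (Z.biUnion fun v => G.neighborFinset v).card ≤ ∑ v ∈ Z, G.degree v :=
    Finset.card_biUnion_le
  have h3 := Finset.card_union_le Z (Z.biUnion fun v => G.neighborFinset v)
  rw [closedNbhd]
  linarith

end
end SimpleGraph

/-! ### The counting argument. -/

namespace Drawing

open ClosedSurface SimpleGraph

section

open Classical

variable {X V : Type*} [Fintype X] [DecidableEq X] {G : SimpleGraph V} {S : ClosedSurface X}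
  [Fintype V]

/-- The vertices incident with a face of length other than `t`. -/
noncomputable def irregularVertices (D : Drawing G S) (t : ℕ) : Finset V :=
  Finset.univ.filter fun v => ∃ f : D.Face, f.IncidentVertex v ∧ f.length ≠ t

variable {D : Drawing G S}

/-- A face of length $\ell > t$ touches at most $2\ell$ vertices, and $\ell \le (t+1)(\ell - t)$. -/
theorem card_irregularVertices_le {t : ℕ} (hV : ∀ v, ∃ w, G.Adj v w)
    (hl : ∀ f : D.Face, t ≤ f.length) :
    (D.irregularVertices t).card ≤ 2 * (t + 1) * ∑ f : D.Face, (f.length - t) := by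
  have hsub : D.irregularVertices t ⊆ (Finset.univ.filter fun f : D.Face => f.length ≠ t).biUnion
      fun f => (G.edgeFinset.filter fun e => 0 < f.sideCount e).biUnion fun e => e.toFinset := by
    intro v hv
    obtain ⟨f, hf, hne⟩ := (Finset.mem_filter.1 hv).2
    obtain ⟨w, hw⟩ := hV v
    obtain ⟨x, hx, hpos⟩ := exists_incident_edge hw hf
    simp only [Finset.mem_biUnion, Finset.mem_filter, Finset.mem_univ, true_and, mem_edgeFinset]
    exact ⟨f, hne, s(v, x), ⟨hx, hpos⟩, by simp⟩
  have hface : ∀ f : D.Face,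
      ((G.edgeFinset.filter fun e => 0 < f.sideCount e).biUnion fun e => e.toFinset).card ≤
        2 * f.length := by
    intro f
    refine Finset.card_biUnion_le.trans ?_
    rw [Face.length, Finset.mul_sum, Finset.sum_filter]
    refine Finset.sum_le_sum fun e _ => ?_
    have : e.toFinset.card ≤ 2 := by
      induction e with
      | _ a b => rw [Sym2.toFinset_mk_eq]; exact Finset.card_le_two
    split_ifs <;> omega
  refine (Finset.card_le_card hsub).trans (Finset.card_biUnion_le.trans ?_)
  rw [Finset.sum_filter, Finset.mul_sum]
  refine Finset.sum_le_sum fun f _ => ?_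
  have h1 := hl f
  split_ifs with h
  · refine (hface f).trans ?_
    obtain ⟨k, hk⟩ := Nat.exists_eq_add_of_lt (lt_of_le_of_ne h1 (Ne.symm h))
    have h2 : f.length - t = k + 1 := by omega
    rw [h2, hk]
    nlinarith
  · exact Nat.zero_le _

theorem two_mul_card_edges_eq {t : ℕ} (hl : ∀ f : D.Face, t ≤ f.length) :
    2 * G.edgeFinset.card = t * Fintype.card D.Face + ∑ f : D.Face, (f.length - t) := by
  rw [← sum_length (D := D), ← Finset.card_univ, mul_comm, ← smul_eq_mul, ← Finset.sum_const,
    ← Finset.sum_add_distrib]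
  exact Finset.sum_congr rfl fun f _ => by have := hl f; omega

theorem eulerChar_le_card [Nonempty V] (D : Drawing G S) :
    S.eulerChar ≤ (Fintype.card V : ℤ) - G.edgeFinset.card + Fintype.card D.Face := by
  have h := eulerChar_le (S := S) (D := D.edges) (Y := Set.range D) ?_ ?_ (Set.range_nonempty _)
  · have hD : Function.Injective D := D.injective
    have h1 : (Set.range D).ncard = Fintype.card V := by
      rw [← Nat.card_coe_set_eq (Set.range D), Nat.card_range_of_injective hD,
        Nat.card_eq_fintype_card]
    have h2 : D.edges.ncard = G.edgeFinset.card := by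
      rw [Drawing.edges, Set.ncard_image_of_injective _ (Sym2.map.injective hD), ← coe_edgeFinset,
        Set.ncard_coe_finset]
    have h3 : Nat.card (S.cutGraph D.edges).ConnectedComponent = Fintype.card D.Face :=
      Nat.card_eq_fintype_card (α := D.Face)
    rwa [h1, h2, h3] at h
  · rintro _ ⟨e, he, rfl⟩
    induction e with
    | _ a b => exact adj_skeleton he
  · rintro _ ⟨e, he, rfl⟩ x hx
    obtain ⟨a, -, rfl⟩ := Sym2.mem_map.1 hx
    exact ⟨a, rfl⟩

/-- If no single-vertex sparsifier appears, then the vertices all of whose faces are regular have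
degree at least `2c`. -/
theorem two_mul_le_degree {c : ℕ} (hfree : D.SparsifierFree c 4) {v : V}
    (hv : ∀ f : D.Face, f.IncidentVertex v → f.IsBoundedByCycle (2 * c / (c - 1))) :
    2 * c ≤ G.degree v := by
  by_contra! h
  let φ : (⊥ : SimpleGraph (Fin 1)) ↪g G :=
    { toFun := fun _ => v
      inj' := fun a b _ => Subsingleton.elim a b
      map_rel_iff' := by simp }
  exact hfree 1 ⊥ (fun _ => G.degree v) (by norm_num) (isSparsifier_single h) φ
    fun _ => ⟨le_rfl, hv⟩

/-- If there are many edges, then some vertex has only vertices of degree `2c` with regular faces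
within distance two. -/
theorem exists_regular_neighborhood {c t : ℕ} (hct : c = 2 ∧ t = 4 ∨ c = 3 ∧ t = 3) [Nonempty V]
    (hdeg : ∀ v, c ≤ G.degree v) (hl : ∀ f : D.Face, t ≤ f.length)
    (hreg : ∀ v, v ∉ D.irregularVertices t → 2 * c ≤ G.degree v)
    (hE : ((c : ℝ) - 1 / 10000) * (Fintype.card V : ℝ) + 10 * ((S.eulerGenus : ℝ) + 3) <
      (G.edgeFinset.card : ℝ)) :
    ∃ Z : Finset V, (∀ v ∉ Z, v ∉ D.irregularVertices t ∧ G.degree v = 2 * c) ∧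
      ∃ u, u ∉ G.closedNbhd (G.closedNbhd Z) := by
  set q := ∑ f : D.Face, (f.length - t) with hq
  set n := Fintype.card V with hn
  set E := G.edgeFinset.card with hEdef
  set P := ∑ v, (G.degree v - 2 * c) with hP
  set N := ∑ v, (2 * c - G.degree v) with hN
  have hV : ∀ v, ∃ w, G.Adj v w := fun v => by
    have : 0 < (G.neighborFinset v).card := lt_of_lt_of_le (by omega) (hdeg v)
    obtain ⟨x, hx⟩ := Finset.card_pos.1 this
    exact ⟨x, by simpa using hx⟩
  have hbad := card_irregularVertices_le hV hl
  have h2E := two_mul_card_edges_eq hl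
  have heuler := eulerChar_le_card D
  have hg := S.eulerGenus_nonneg
  have hgdef : S.eulerGenus = 2 - S.eulerChar := rfl
  have hsum : 2 * E + N = 2 * c * n + P := by
    rw [hEdef, ← G.sum_degrees_eq_twice_card_edges, hN, hP, hn, ← Finset.card_univ,
      mul_comm (2 * c), ← smul_eq_mul (a := Finset.univ.card), ← Finset.sum_const, ← Finset.sum_add_distrib,
      ← Finset.sum_add_distrib]
    exact Finset.sum_congr rfl fun v _ => by omega
  -- Only irregular vertices have degree below $2c$, and each falls short by at most $c \le 3$.
  have hNle : N ≤ 3 * (D.irregularVertices t).card := by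
    rw [hN, mul_comm 3, ← smul_eq_mul (b := 3), ← Finset.sum_const]
    rw [← Finset.sum_subset (Finset.subset_univ (D.irregularVertices t))]
    · refine Finset.sum_le_sum fun v _ => ?_
      have := hdeg v
      omega
    · intro v _ hv
      have := hreg v hv
      omega
  have hlarge : (Finset.univ.filter fun v => 2 * c < G.degree v).card ≤ P := by
    rw [Finset.card_filter]
    refine Finset.sum_le_sum fun v _ => ?_
    split_ifs <;> omega
  refine ⟨D.irregularVertices t ∪ Finset.univ.filter fun v => 2 * c < G.degree v, ?_, ?_⟩
  · intro v hv
    rw [Finset.mem_union, not_or] at hv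
    refine ⟨hv.1, le_antisymm ?_ (hreg v hv.1)⟩
    simpa using hv.2
  · by_contra! hcon
    have hZ := Finset.card_union_le (D.irregularVertices t)
      (Finset.univ.filter fun v => 2 * c < G.degree v)
    set Z := D.irregularVertices t ∪ Finset.univ.filter fun v => 2 * c < G.degree v with hZdef
    have h1 := card_closedNbhd_le (G := G) (2 * c) Z
    have h2 := card_closedNbhd_le (G := G) (2 * c) (G.closedNbhd Z)
    have h3 : n ≤ (G.closedNbhd (G.closedNbhd Z)).card := by
      rw [hn, ← Finset.card_univ]
      exact Finset.card_le_card fun v _ => hcon v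
    have hnpos : 0 < n := Fintype.card_pos
    set g := S.eulerGenus
    set χ := S.eulerChar
    set b := (D.irregularVertices t).card
    set F := Fintype.card D.Face
    rw [← hq] at hbad h2E
    rw [← hP] at h1 h2
    generalize (G.closedNbhd (G.closedNbhd Z)).card = z2 at *
    generalize (G.closedNbhd Z).card = z1 at *
    generalize Z.card = z at *
    generalize (Finset.univ.filter fun v => 2 * c < G.degree v).card = l at *
    -- What remains is linear. For $c = 2$, with $\varepsilon = 1/10000$: $q < 2\varepsilon n$, at
    -- most $20\varepsilon n$ vertices are irregular, and $P < 58\varepsilon n$. Two rounds of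
    -- neighborhoods then stay below $2500\varepsilon n < n$; the case $c = 3$ is milder.
    have hE' : (c : ℤ) * n * 10000 - n + 100000 * (g + 3) < 10000 * E := by
      have : ((c : ℝ) * n * 10000 - n + 100000 * (g + 3)) < 10000 * E := by linarith
      exact_mod_cast this
    clear hE
    rcases hct with ⟨rfl, rfl⟩ | ⟨rfl, rfl⟩ <;> push_cast at hE' <;> omega

end
end Drawing

/-! ### Appearances in a regular neighborhood, and the conclusion. -/

namespace Drawing

open ClosedSurface SimpleGraph

section

open Classical

variable {X V : Type*} [Fintype X] [DecidableEq X] {G : SimpleGraph V} {S : ClosedSurface X}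
  [Fintype V] {D : Drawing G S}

theorem length_eq_of_notMem {t : ℕ} {v : V} (hv : v ∉ D.irregularVertices t) {f : D.Face}
    (hf : f.IncidentVertex v) : f.length = t := by
  by_contra h
  exact hv (Finset.mem_filter.2 ⟨Finset.mem_univ _, f, hf, h⟩)

theorem isBoundedByCycle_of_notMem {t : ℕ} [Nonempty V] (hdeg : ∀ v, 2 ≤ G.degree v)
    (ht : t = 3 ∨ t = 4 ∧ 4 ≤ G.egirth) {v : V} (hv : v ∉ D.irregularVertices t) {f : D.Face}
    (hf : f.IncidentVertex v) : f.IsBoundedByCycle t :=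
  isBoundedByCycle_of_length_eq hdeg ht (length_eq_of_notMem hv hf)

/-- A face at `u` is a 4-cycle, and either diagonal would create a triangle. The distance clause
places all four vertices in the regular neighborhood of `u`. -/
theorem exists_quadrangle [Nonempty V] (hdeg : ∀ v, 2 ≤ G.degree v) (hG : 4 ≤ G.egirth) {u : V}
    (hu : u ∉ D.irregularVertices 4) :
    ∃ h : quadrangle ↪g G, ∀ i, h i = u ∨ ∃ w, G.Adj (h i) w ∧ (w = u ∨ G.Adj w u) := by
  have : 0 < (G.neighborFinset u).card := lt_of_lt_of_le two_pos (hdeg u)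
  obtain ⟨a, ha⟩ := Finset.card_pos.1 this
  rw [mem_neighborFinset] at ha
  obtain ⟨f, -, hf, -⟩ := exists_two_faces (D := D) ha
  obtain ⟨-, b, c, hb, hac, hbc, hab, huc, -⟩ := exists_quadrangle_of_length_eq hdeg hG
    (length_eq_of_notMem hu (incidentVertex_of_sideCount_pos hf (by simp))) ha hf
  have n1 : ¬ G.Adj u c := fun h => not_adj_of_four_le_egirth hG ha hac.1 h.symm
  have n2 : ¬ G.Adj a b := fun h => not_adj_of_four_le_egirth hG ha h hb.1.symm
  have h1 := ha.ne
  have h2 := hb.1.ne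
  have h3 := hac.1.ne
  have h4 := hbc.1.ne
  refine ⟨⟨⟨![u, a, c, b], ?_⟩, ?_⟩, ?_⟩
  · intro i j h
    fin_cases i <;> fin_cases j <;> simp at h ⊢ <;> grind
  · intro i j
    change G.Adj (![u, a, c, b] i) (![u, a, c, b] j) ↔ quadrangle.Adj i j
    have hb' := hb.1
    have hac' := hac.1
    have hbc' := hbc.1
    fin_cases i <;> fin_cases j <;> simp [quadrangle, *, ha.symm, hb'.symm, hac'.symm, hbc'.symm,
      G.adj_comm c u, G.adj_comm b a]
  · intro i
    fin_cases i
    · exact .inl rfl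
    · exact .inr ⟨u, ha.symm, .inl rfl⟩
    · exact .inr ⟨a, hac.1.symm, .inr ha.symm⟩
    · exact .inr ⟨u, hb.1.symm, .inl rfl⟩

theorem exists_diamond_embedding [Nonempty V] (hdeg : ∀ v, 2 ≤ G.degree v)
    (hc : ∀ (v : V) (C : G.Walk v v), C.IsCycle → C.length ≤ 4 → D.IsContractible C)
    (hs : ∀ (v : V) (C : G.Walk v v), C.IsCycle → C.length = 3 → ¬ D.IsSeparating C)
    {u : V} (hu : u ∉ D.irregularVertices 3) (h4 : 4 ≤ G.degree u) :
    ∃ h : diamond ↪g G, ∀ i, h i = u ∨ ∃ w, G.Adj (h i) w ∧ (w = u ∨ G.Adj w u) := by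
  have : 0 < (G.neighborFinset u).card := lt_of_lt_of_le two_pos (hdeg u)
  obtain ⟨v, hv⟩ := Finset.card_pos.1 this
  rw [mem_neighborFinset] at hv
  obtain ⟨x, y, hxy, hux, huy, hvx, hvy, hn⟩ :=
    exists_diamond hdeg hc hs (fun f hf => length_eq_of_notMem hu hf) h4 hv
  have h1 := hv.ne
  have h2 := hux.ne
  have h3 := huy.ne
  have h4 := hvx.ne
  have h5 := hvy.ne
  refine ⟨⟨⟨![u, v, x, y], ?_⟩, ?_⟩, ?_⟩
  · intro i j h
    fin_cases i <;> fin_cases j <;> simp at h ⊢ <;> grind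
  · intro i j
    change G.Adj (![u, v, x, y] i) (![u, v, x, y] j) ↔ diamond.Adj i j
    fin_cases i <;> fin_cases j <;> simp [diamond, *, hv.symm, hux.symm, huy.symm, hvx.symm,
      hvy.symm, G.adj_comm y x]
  · intro i
    fin_cases i
    · exact .inl rfl
    · exact .inr ⟨u, hv.symm, .inl rfl⟩
    · exact .inr ⟨u, hux.symm, .inl rfl⟩
    · exact .inr ⟨u, huy.symm, .inl rfl⟩

theorem card_edges_le {c : ℕ} (hc : c = 2 ∨ c = 3) (hdeg : ∀ v, c ≤ G.degree v)
    (hgirth : ((2 * c / (c - 1) : ℕ) : ℕ∞) ≤ G.egirth)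
    (hcontr : ∀ (v : V) (C : G.Walk v v), C.IsCycle → C.length ≤ 4 → D.IsContractible C)
    (hfree : D.SparsifierFree c 4)
    (hsep : ∀ (v : V) (C : G.Walk v v), C.IsCycle → C.length = 2 * c / (c - 1) →
      ¬ D.IsSeparating C) :
    (G.edgeFinset.card : ℝ) ≤
      ((c : ℝ) - 1 / 10000) * (Fintype.card V : ℝ) + 10 * ((S.eulerGenus : ℝ) + 3) := by
  by_contra! hE
  have hdeg2 : ∀ v, 2 ≤ G.degree v := fun v => le_trans (by omega) (hdeg v)
  rcases isEmpty_or_nonempty V with hV | hV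
  -- The graph without vertices is treated apart, because Euler's inequality needs a point.
  · have hg : (0 : ℝ) ≤ S.eulerGenus := by exact_mod_cast S.eulerGenus_nonneg
    have h0 : G.edgeFinset.card = 0 := by
      rw [Finset.card_eq_zero, Finset.eq_empty_iff_forall_notMem]
      intro e
      induction e with
      | _ a => exact isEmptyElim a
    rw [h0, Fintype.card_eq_zero] at hE
    norm_num at hE
    linarith
  obtain ⟨t, ht, hct⟩ : ∃ t, 2 * c / (c - 1) = t ∧ (c = 2 ∧ t = 4 ∨ c = 3 ∧ t = 3) := by
    rcases hc with rfl | rfl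
    · exact ⟨4, rfl, .inl ⟨rfl, rfl⟩⟩
    · exact ⟨3, rfl, .inr ⟨rfl, rfl⟩⟩
  have ht' : t = 3 ∨ t = 4 ∧ 4 ≤ G.egirth := by
    rcases hct with ⟨rfl, rfl⟩ | ⟨rfl, rfl⟩
    · exact .inr ⟨rfl, by exact_mod_cast hgirth⟩
    · exact .inl rfl
  have hreg : ∀ v, v ∉ D.irregularVertices t → 2 * c ≤ G.degree v := fun v hv =>
    two_mul_le_degree hfree fun f hf => ht ▸ isBoundedByCycle_of_notMem hdeg2 ht' hv hf
  obtain ⟨Z, hZ, u, hu⟩ := exists_regular_neighborhood hct hdeg (le_length hdeg2 ht') hreg hE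
  have hfar : ∀ v, (v = u ∨ ∃ w, G.Adj v w ∧ (w = u ∨ G.Adj w u)) → v ∉ Z := by
    have hsub : ∀ Z : Finset V, Z ⊆ G.closedNbhd Z := fun Z => Finset.subset_union_left
    rintro v (rfl | ⟨w, hvw, rfl | hwu⟩) hv
    · exact hu (hsub _ (hsub _ hv))
    · exact hu (hsub _ (mem_closedNbhd_of_adj hvw.symm hv))
    · exact hu (mem_closedNbhd_of_adj hwu.symm (mem_closedNbhd_of_adj hvw.symm hv))
  have huZ := hZ u (hfar u (.inl rfl))
  have happ : ∀ {H : SimpleGraph (Fin 4)} (h : H ↪g G),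
      (∀ i, h i = u ∨ ∃ w, G.Adj (h i) w ∧ (w = u ∨ G.Adj w u)) →
      D.IsAppearance c (fun _ => 2 * c) h := fun h hh i =>
    ⟨(hZ _ (hfar _ (hh i))).2.le, fun f hf => ht ▸
      isBoundedByCycle_of_notMem hdeg2 ht' (hZ _ (hfar _ (hh i))).1 hf⟩
  rcases hct with ⟨rfl, rfl⟩ | ⟨rfl, rfl⟩
  · obtain ⟨h, hh⟩ := exists_quadrangle hdeg2 (by exact_mod_cast hgirth) huZ.1
    exact hfree 4 quadrangle (fun _ => 4) le_rfl isSparsifier_quadrangle h (happ h hh)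
  · obtain ⟨h, hh⟩ := exists_diamond_embedding hdeg2 hcontr hsep huZ.1 (by rw [huZ.2]; norm_num)
    exact hfree 4 diamond (fun _ => 6) le_rfl isSparsifier_diamond h (happ h hh)

end
end Drawing

theorem mainTheorem4 (c : ℕ) (hc : c = 2 ∨ c = 3) :
    ∃ ε : ℝ, 0 < ε ∧
      ∀ (X V : Type*) [Fintype X] [DecidableEq X] [Fintype V] [DecidableEq V]
        (S : ClosedSurface X) (G : SimpleGraph V) [DecidableRel G.Adj] (D : Drawing G S),
        (∀ v, c ≤ G.degree v) →
        ((2 * c / (c - 1) : ℕ) : ℕ∞) ≤ G.egirth →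
        (∀ (v : V) (C : G.Walk v v), C.IsCycle → C.length ≤ 4 → D.IsContractible C) →
        D.SparsifierFree c 4 →
        (∀ (v : V) (C : G.Walk v v), C.IsCycle → C.length = 2 * c / (c - 1) →
          ¬ D.IsSeparating C) →
        (G.edgeFinset.card : ℝ) ≤
          ((c : ℝ) - ε) * (Fintype.card V : ℝ) + 10 * ((S.eulerGenus : ℝ) + 3) := by
  refine ⟨1 / 10000, by norm_num, ?_⟩
  intro X V _ _ _ _ S G inst D hdeg hgirth hcontr hfree hsep
  -- Degrees and `edgeFinset` depend on the decidability instance, which is classical in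
  -- `card_edges_le`.
  obtain rfl : inst = fun a b => Classical.propDecidable (G.Adj a b) := Subsingleton.elim _ _
  have := Drawing.card_edges_le (D := D) hc (fun v => by convert hdeg v) hgirth hcontr
    hfree hsep
  convert this
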